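/- Fix an integer $m\ge 2$ and a real number $0\le\alpha<1$, and put $u=\frac{\alpha}{1-\alpha}$ and $\chi=\frac{1+2u}{2+2u}\in[\tfrac12,1)$. The sequential preferential attachment graphs $(G_n)_{n\ge1}$, where $G_n$ is a multigraph on the vertices $1,\dots,n$, are defined as follows. $G_1$ has no edges, and $G_2$ consists of $m$ edges between $1$ and $2$. For $n\ge3$, $G_n$ arises from $G_{n-1}$ by adding the vertex $n$ and $m$ edges from $n$ to vertices $w_1,\dots,w_m\in\{1,\dots,n-1\}$ chosen one after the other: given $G_{n-1}$ and $w_1,\dots,w_{i-1}$, for $1\le v\le n-1$, $$\mathbb P(w_i=v)=\tilde\alpha\,\frac1{n-1}+(1-\tilde\alpha)\,\frac{\deg_{n-1}(v)+\#\{1\le j\le i-1: w_j=v\}}{2m(n-2)+i-1},\qquad \tilde\alpha=\alpha\,\frac{2m(n-1)}{2m(n-2)+2m\alpha+(1-\alpha)(i-1)} .$$ Let $d_n(k)$ be the degree of the vertex $k$ in $G_n$. Let $\psi_1=1$ and let $\psi_2,\psi_3,\dots$ be independent random variables such that $\psi_j$ has the Beta distribution with parameters $m+2mu$ and $(2j-3)m+2mu(j-1)$,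 that is, a density on $[0,1]$ proportional to $x^{m+2mu-1}(1-x)^{(2j-3)m+2mu(j-1)-1}$. Then the following holds. 1. For every $k\ge1$ the limit $$F_k=\lim_{\ell\to\infty}\Bigl(\frac{\ell}{k}\Bigr)^{\chi}\prod_{j=k+1}^{\ell}(1-\psi_j)$$ exists almost surely and in $L^2$. 2. For every fixed $k\ge1$, $$\frac{d_n(k)}{n^{1-\chi}}\to\frac{m}{1-\chi}\,k^{\chi}\,\psi_k F_k\qquad(n\to\infty)$$ in distribution, and the expectation of the left-hand side converges to the (finite) expectation of the right-hand side. 3. $F_k>0$ almost surely for every $k\ge1$; $\log F_k=O_P(k^{-1/2})$, i.e. the sequence $(k^{1/2}\log F_k)_{k\ge1}$ is bounded in probability; and $\mathbb E[F_k]=1+O(k^{-1})$. 4. For every $k\ge1$, $$\lim_{n\to\infty}\frac{\mathbb E[d_n(k)]}{n^{1-\chi}}=\frac{m\chi}{1-\chi}\,\frac1{k^{1-\chi}}\,\bigl(1+O(k^{-1})\bigr).$$ The constants in the $O$-symbols depend only on $m$ and $\alpha$. -/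

import Mathlib

open MeasureTheory ProbabilityTheory Filter Topology

namespace PrefAttach

noncomputable section

/-! ### The sequential preferential attachment graph -/

/-- Undirected multigraphs with vertices labelled by natural numbers, given by the multiset of
their edges. -/
abbrev Multigraph : Type := Multiset (Sym2 ℕ)

instance : MeasurableSpace Multigraph := ⊤

/-- The degree of the vertex `k`: the number of edges, with multiplicity, incident to `k`
(the graphs below have no loops). -/
def deg (G : Multigraph) (k : ℕ) : ℕ := G.countP (fun e => k ∈ e)

/-- The probability `α̃` of a uniform connection used for the `i`-th edge of the new vertex `n`;
the argument `r` is `i - 1`, the number of edges that `n` has already sent out. -/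
def alphaTilde (m : ℕ) (α : ℝ) (n r : ℕ) : ℝ :=
  α * (2 * m * ((n : ℝ) - 1)) /
    (2 * m * ((n : ℝ) - 2) + 2 * m * α + (1 - α) * r)

/-- The probability that the `i`-th edge of the new vertex `n` is attached to the old vertex `k`,
when `G` is the graph on `1, …, n - 1` and `w` is the list of the `i - 1` end points
`w_1, …, w_{i-1}` chosen so far: with probability `α̃` the end point is uniform, and otherwise it
is chosen proportionally to `deg'(k) = deg(k) + #{j < i : w_j = k}`. -/
def attachProb (m : ℕ) (α : ℝ) (n : ℕ) (G : Multigraph) (w : List ℕ) (k : ℕ) : ℝ :=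
  alphaTilde m α n w.length / ((n : ℝ) - 1) +
    (1 - alphaTilde m α n w.length) *
      (((deg G k + w.count k : ℕ) : ℝ) / (2 * m * ((n : ℝ) - 2) + w.length))

open Classical in
/-- The law on `{1, …, n - 1}` of the next end point, with the probabilities `attachProb`. These
add up to one in every configuration that can occur (see `sum_attachProb_eq_one` below), so the
second branch is never used. -/
def attachLaw (m : ℕ) (α : ℝ) (n : ℕ) (G : Multigraph) (w : List ℕ) : PMF ℕ :=
  if h : ∑ k ∈ Finset.Icc 1 (n - 1), ENNReal.ofReal (attachProb m α n G w k) = 1 then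
    PMF.ofFinset
      (fun k => if k ∈ Finset.Icc 1 (n - 1) then ENNReal.ofReal (attachProb m α n G w k) else 0)
      (Finset.Icc 1 (n - 1))
      (by rw [← h]; exact Finset.sum_congr rfl fun k hk => if_pos hk)
      (fun _ hk => if_neg hk)
  else PMF.pure 1

/-- The law of the list of the first `r` end points chosen by the new vertex `n`
(most recent choice first). -/
def targetsLaw (m : ℕ) (α : ℝ) (n : ℕ) (G : Multigraph) : ℕ → PMF (List ℕ)
  | 0 => PMF.pure []
  | r + 1 => (targetsLaw m α n G r).bind fun w =>
      (attachLaw m α n G w).map fun v => v :: w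

/-- The graph `G` together with the edges from the new vertex `n` to the vertices listed
in `w`. -/
def addEdges (n : ℕ) (G : Multigraph) (w : List ℕ) : Multigraph :=
  G + ((w : Multiset ℕ).map fun v => s(n, v))

/-- The law of the sequential preferential attachment graph `G_n` on the vertices `1, …, n`:
`G_1` has no edges, `G_2` consists of `m` edges between `1` and `2`, and `G_n` arises from
`G_{n-1}` by adding the vertex `n` with `m` edges whose other end points are chosen
sequentially. (`n = 0` is a dummy value.) -/
def graphLaw (m : ℕ) (α : ℝ) : ℕ → PMF Multigraph
  | 0 => PMF.pure 0
  | 1 => PMF.pure 0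
  | 2 => PMF.pure (Multiset.replicate m s(2, 1))
  | n + 3 => (graphLaw m α (n + 2)).bind fun G =>
      (targetsLaw m α (n + 3) G m).map (addEdges (n + 3) G)

/-! ### The Pólya urn strengths and the limits `F_k` -/

/-- `u = α / (1 - α)`. -/
def uParam (α : ℝ) : ℝ := α / (1 - α)

/-- `χ = (1 + 2u) / (2 + 2u)`. -/
def chi (α : ℝ) : ℝ := (1 + 2 * uParam α) / (2 + 2 * uParam α)

/-- The random variables `ψ_1, ψ_2, …` of the Pólya urn representation: `ψ_1 = 1`, and
`ψ_2, ψ_3, …` are independent with `ψ_j ∼ β(m + 2mu, (2j - 3)m + 2mu(j - 1))`.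
(The value `ψ 0` is irrelevant.) -/
structure IsPolyaStrengths {Ω : Type*} [MeasurableSpace Ω] (m : ℕ) (α : ℝ) (ψ : ℕ → Ω → ℝ)
    (P : Measure Ω) : Prop where
  one : ∀ᵐ ω ∂P, ψ 1 ω = 1
  law : ∀ j : ℕ, 2 ≤ j → HasLaw (ψ j)
    (betaMeasure (m + 2 * m * uParam α)
      ((2 * (j : ℝ) - 3) * m + 2 * m * uParam α * ((j : ℝ) - 1))) P
  indep : iIndepFun (fun j : ℕ => ψ (j + 2)) P

/-- `(ℓ / k) ^ χ * ∏_{j = k + 1}^ℓ (1 - ψ_j)`. -/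
def partialF {Ω : Type*} (α : ℝ) (ψ : ℕ → Ω → ℝ) (k ℓ : ℕ) (ω : Ω) : ℝ :=
  ((ℓ : ℝ) / k) ^ chi α * ∏ j ∈ Finset.Icc (k + 1) ℓ, (1 - ψ j ω)

/-- `F_k`, the pointwise limit of `partialF` as `ℓ → ∞` (an arbitrary value where the limit does
not exist). -/
def limF {Ω : Type*} (α : ℝ) (ψ : ℕ → Ω → ℝ) (k : ℕ) (ω : Ω) : ℝ :=
  limUnder atTop fun ℓ : ℕ => partialF α ψ k ℓ ω

/-- The limiting variable `m / (1 - χ) * k ^ χ * ψ_k * F_k`. -/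
def degLimit {Ω : Type*} (m : ℕ) (α : ℝ) (ψ : ℕ → Ω → ℝ) (k : ℕ) (ω : Ω) : ℝ :=
  (m : ℝ) / (1 - chi α) * (k : ℝ) ^ chi α * ψ k ω * limF α ψ k ω

/-- The rescaled degree `d_n(k) / n ^ (1 - χ)`, as a function of the graph `G = G_n`. -/
def scaledDeg (α : ℝ) (k n : ℕ) (G : Multigraph) : ℝ :=
  (deg G k : ℝ) / (n : ℝ) ^ (1 - chi α)

/-- `A_k = O_P(k ^ (-1/2))` for `k ≥ 1`: the sequence `A_k * k ^ (1/2)` is bounded in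
probability. -/
def IsBigOPInvSqrt {Ω : Type*} [MeasurableSpace Ω] (P : Measure Ω) (A : ℕ → Ω → ℝ) : Prop :=
  ∀ ε : ℝ, 0 < ε → ∃ C : ℝ, ∀ k : ℕ, 1 ≤ k →
    P {ω | C < |A k ω| * Real.sqrt k} ≤ ENNReal.ofReal ε

/-! ### The attachment probabilities add up to one -/

lemma sum_countP_mem (s : Finset ℕ) (G : Multigraph)
    (h : ∀ e ∈ G, ¬ e.IsDiag ∧ ∀ v ∈ e, v ∈ s) :
    ∑ k ∈ s, deg G k = 2 * G.card := by
  induction G using Multiset.induction_on with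
  | empty => simp [deg]
  | cons e G ih =>
    have h1 : ∑ k ∈ s, deg G k = 2 * Multiset.card G :=
      ih fun e' he' => h e' (Multiset.mem_cons_of_mem he')
    have h2 := h e (Multiset.mem_cons_self e G)
    have h3 : ∑ k ∈ s, (if k ∈ e then 1 else 0) = 2 := by
      revert h2
      induction e using Sym2.ind with
      | _ a b =>
        intro h2
        rw [Finset.sum_boole]
        have : s.filter (fun k => k ∈ s(a, b)) = {a, b} := by
          ext x
          simp only [Finset.mem_filter, Sym2.mem_iff, Finset.mem_insert, Finset.mem_singleton]
          constructor
          · exact fun hx => hx.2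
          · intro hx
            refine ⟨?_, hx⟩
            rcases hx with rfl | rfl
            · exact h2.2 _ (Sym2.mem_mk_left _ _)
            · exact h2.2 _ (Sym2.mem_mk_right _ _)
        rw [this, Finset.card_pair (by simpa using h2.1)]
        rfl
    simp only [deg, Multiset.countP_cons, Finset.sum_add_distrib, Multiset.card_cons] at h1 ⊢
    rw [h1, h3]
    ring

/-- The end points chosen by the vertex `n` lie in `{1, …, n - 1}`. -/
lemma targetsLaw_support {m : ℕ} {α : ℝ} {n : ℕ} (hn : 2 ≤ n) {G : Multigraph} {r : ℕ}
    {w : List ℕ} (hw : w ∈ (targetsLaw m α n G r).support) :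
    w.length = r ∧ ∀ v ∈ w, v ∈ Finset.Icc 1 (n - 1) := by
  induction r generalizing w with
  | zero => simp_all [targetsLaw]
  | succ r ih =>
    simp only [targetsLaw, PMF.mem_support_bind_iff, PMF.mem_support_map_iff] at hw
    obtain ⟨w', hw', v, hv, rfl⟩ := hw
    obtain ⟨h1, h2⟩ := ih hw'
    have h3 : v ∈ Finset.Icc 1 (n - 1) := by
      unfold attachLaw at hv
      split_ifs at hv with h
      · by_contra hc
        rw [PMF.mem_support_iff, PMF.ofFinset_apply, if_neg hc] at hv
        exact hv rfl
      · simp only [PMF.support_pure, Set.mem_singleton_iff] at hv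
        subst hv
        simp only [Finset.mem_Icc]
        omega
    refine ⟨by simp [h1], ?_⟩
    intro x hx
    rcases List.mem_cons.1 hx with rfl | hx
    · exact h3
    · exact h2 x hx

/-- `G_n` has no loops, its edges lie in `{1, …, n}`, and it has `m * (n - 1)` edges. -/
lemma graphLaw_support {m : ℕ} {α : ℝ} (n : ℕ) {G : Multigraph}
    (hG : G ∈ (graphLaw m α (n + 2)).support) :
    (∀ e ∈ G, ¬ e.IsDiag ∧ ∀ v ∈ e, v ∈ Finset.Icc 1 (n + 2)) ∧ G.card = m * (n + 1) := by
  induction n generalizing G with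
  | zero =>
    simp only [graphLaw, PMF.support_pure, Set.mem_singleton_iff] at hG
    subst hG
    refine ⟨fun e he => ?_, by simp⟩
    rw [Multiset.eq_of_mem_replicate he]
    refine ⟨by simp, fun v hv => ?_⟩
    rcases Sym2.mem_iff.1 hv with rfl | rfl <;> simp
  | succ n ih =>
    simp only [graphLaw, PMF.mem_support_bind_iff, PMF.mem_support_map_iff] at hG
    obtain ⟨G', hG', w, hw, rfl⟩ := hG
    obtain ⟨h1, h2⟩ := ih hG'
    obtain ⟨h3, h4⟩ := targetsLaw_support (by omega) hw
    refine ⟨fun e he => ?_, ?_⟩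
    · rcases Multiset.mem_add.1 he with he | he
      · refine ⟨(h1 e he).1, fun v hv => ?_⟩
        have := Finset.mem_Icc.1 ((h1 e he).2 v hv)
        exact Finset.mem_Icc.2 ⟨this.1, by omega⟩
      · obtain ⟨v, hv, rfl⟩ := Multiset.mem_map.1 he
        have hv' := Finset.mem_Icc.1 (h4 v (Multiset.mem_coe.1 hv))
        refine ⟨?_, fun x hx => ?_⟩
        · rw [Sym2.mk_isDiag_iff]; omega
        · rw [Finset.mem_Icc]
          rcases Sym2.mem_iff.1 hx with rfl | rfl <;> omega
    · simp only [addEdges, Multiset.card_add, Multiset.card_map, Multiset.coe_card, h2, h3]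
      ring

/-- In every configuration that can occur, the attachment probabilities are nonnegative and add
up to one, so that `attachLaw` is given by `attachProb`. -/
theorem sum_attachProb_eq_one {m : ℕ} (hm : 1 ≤ m) {α : ℝ} (h0 : 0 ≤ α) (h1 : α < 1) (n : ℕ)
    {G : Multigraph} (hG : G ∈ (graphLaw m α (n + 2)).support) {r : ℕ} {w : List ℕ}
    (hw : w ∈ (targetsLaw m α (n + 3) G r).support) :
    (∀ k, 0 ≤ attachProb m α (n + 3) G w k) ∧
      ∑ k ∈ Finset.Icc 1 (n + 3 - 1), ENNReal.ofReal (attachProb m α (n + 3) G w k) = 1 := by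
  obtain ⟨hG1, hG2⟩ := graphLaw_support n hG
  obtain ⟨-, hw2⟩ := targetsLaw_support (by omega) hw
  have hm' : (1 : ℝ) ≤ m := by exact_mod_cast hm
  have hn0 : (0 : ℝ) ≤ n := n.cast_nonneg
  have hr0 : (0 : ℝ) ≤ w.length := w.length.cast_nonneg
  have hZ : 0 < 2 * (m : ℝ) * ((n : ℝ) + 3 - 2) + w.length := by nlinarith
  have hD : 0 < 2 * (m : ℝ) * ((n : ℝ) + 3 - 2) + 2 * m * α + (1 - α) * w.length := by
    have : 0 ≤ 2 * (m : ℝ) * α := by positivity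
    have : 0 ≤ (1 - α) * w.length := mul_nonneg (by linarith) hr0
    nlinarith
  have ha0 : 0 ≤ alphaTilde m α (n + 3) w.length := by
    unfold alphaTilde
    push_cast
    refine div_nonneg (mul_nonneg h0 (mul_nonneg (by positivity) (by linarith))) hD.le
  have ha1 : alphaTilde m α (n + 3) w.length ≤ 1 := by
    unfold alphaTilde
    push_cast
    rw [div_le_one hD]
    have e1 : 0 ≤ (1 - α) * (2 * m * ((n : ℝ) + 1)) :=
      mul_nonneg (by linarith) (by positivity)
    have e2 : 0 ≤ (1 - α) * w.length := mul_nonneg (by linarith) hr0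
    nlinarith
  have hpos : ∀ k, 0 ≤ attachProb m α (n + 3) G w k := by
    intro k
    unfold attachProb
    push_cast
    refine add_nonneg (div_nonneg ha0 (by linarith)) (mul_nonneg (by linarith)
      (div_nonneg (by positivity) hZ.le))
  refine ⟨hpos, ?_⟩
  have hs1 : ∑ k ∈ Finset.Icc 1 (n + 2), deg G k = 2 * (m * (n + 1)) := by
    rw [sum_countP_mem _ _ hG1, hG2]
  have hs2 : ∑ k ∈ Finset.Icc 1 (n + 2), w.count k = w.length := by
    have := Multiset.sum_count_eq_card (s := Finset.Icc 1 (n + 2)) (m := (w : Multiset ℕ))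
      (fun v hv => hw2 v (Multiset.mem_coe.1 hv))
    simpa using this
  rw [← ENNReal.ofReal_sum_of_nonneg fun k _ => hpos k, ← ENNReal.ofReal_one]
  congr 1
  unfold attachProb
  rw [Finset.sum_add_distrib, ← Finset.mul_sum, ← Finset.sum_div, ← Finset.sum_div,
    ← Nat.cast_sum,
    Nat.add_sub_assoc (by norm_num), Finset.sum_add_distrib, hs1, hs2]
  simp only [Finset.sum_const, Nat.card_Icc, nsmul_eq_mul]
  push_cast
  have e3 : (n : ℝ) + 3 - 1 ≠ 0 := by linarith
  have e4 : 2 * (m * ((n : ℝ) + 1)) + w.length = 2 * (m : ℝ) * ((n : ℝ) + 3 - 2) + w.length := by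
    ring
  rw [e4, div_self hZ.ne']
  field_simp
  ring

end

end PrefAttach

open PrefAttach

/-!
The attachment rule is attachment with probability proportional to `deg + 2mu` (`attachProb_eq`).
Hence the weight `X_n = deg(k) + 2mu` of a fixed vertex `k` is a Markov chain: at every step it
increases by one with probability proportional to itself. For such an urn the expectation of the
rising factorial `X (X + 1) ⋯ (X + p - 1)` is multiplied by `1 + p / T` at a step with total
weight `T`. The resulting product telescopes into quotients of rising factorials which are exactly
the moments of Beta variables, so that (`expect_graphLaw`, `IsPolyaStrengths.integral_strength`)

  `E [X_n ⋯ (X_n + p - 1)] = W_n (W_n + 1) ⋯ (W_n + p - 1) * E [S_n ^ p]`,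
  `S_n = ψ_k * ∏_{j = k + 1}^n (1 - ψ_j)`,

where `W_n` is the total weight of `G_n`. Summing over `p` against the binomial series turns this
into `E (1 + z) ^ (-X_n) = E (1 + z S_n) ^ (-W_n)` for `0 ≤ z < 1`
(`IsPolyaStrengths.integral_one_add_rpow_deg`). With `1 + z = e ^ (t / n ^ (1 - χ))` the right-hand
side converges by dominated convergence, because `W_n S_n / n ^ (1 - χ)` tends to
`m / (1 - χ) * k ^ χ * ψ_k * F_k` almost surely; so the Laplace transforms of the rescaled degrees
converge, and a Stone–Weierstrass argument on the half line
(`tendstoInDistribution_of_tendsto_laplace`) gives convergence in distribution. The case `p = 1`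
gives the convergence of the expectations.

For the limits `F_k` themselves, write `F_{k, l}` for the partial product. Its factors
`(j / (j - 1)) ^ χ * (1 - ψ_j)` are independent with first and second moments `1 + O(j ^ (-2))`, so
`E (F_{k, l} - F_{k, n}) ^ 2 = O(1 / n)` for `k ≤ n ≤ l`
(`IsPolyaStrengths.integral_sq_partialF_sub_le`). This gives almost sure convergence along
the fourth powers, and hence along all `l` since `∏ (1 - ψ_j)` is monotone
(`tendsto_of_tendsto_pow_four`); Fatou's lemma then gives convergence in `L²`. As `F_{k, k} = 1`, the
same estimate yields `E (F_k - 1) ^ 2 = O(1 / k)`, from which the bound on `log F_k` follows, and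
also positivity, since `F_k` is a positive multiple of `F_l` for every `l ≥ k`.
-/

namespace PrefAttach

/-! ### Moments of the Beta distribution -/

lemma Gamma_add_natCast {x : ℝ} (hx : 0 < x) (p : ℕ) :
    Real.Gamma (x + p) = (ascPochhammer ℝ p).eval x * Real.Gamma x := by
  induction p with
  | zero => simp
  | succ p ih =>
    rw [Nat.cast_succ, ← add_assoc, Real.Gamma_add_one (by positivity), ih,
      ascPochhammer_succ_eval]
    ring

lemma ascPochhammer_eval_pos {x : ℝ} (hx : 0 < x) (p : ℕ) :
    0 < (ascPochhammer ℝ p).eval x :=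
  ascPochhammer_pos p x hx

lemma ae_betaMeasure_mem_Ioo (a b : ℝ) : ∀ᵐ x ∂betaMeasure a b, x ∈ Set.Ioo (0 : ℝ) 1 := by
  rw [betaMeasure, ae_withDensity_iff (by unfold betaPDF; fun_prop)]
  refine Eventually.of_forall fun x hx => ?_
  by_contra hc
  exact hx ((betaPDF_eq a b x).trans (by rw [if_neg (by exact hc), ENNReal.ofReal_zero]))

/-- The density of the Beta distribution times `x ^ p * (1 - x) ^ q` is a multiple of a Beta
density, whose total mass is one. -/
lemma integral_pow_mul_pow_betaMeasure {a b : ℝ} (ha : 0 < a) (hb : 0 < b) (p q : ℕ) :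
    ∫ x, x ^ p * (1 - x) ^ q ∂betaMeasure a b = beta (a + p) (b + q) / beta a b := by
  have h0 : 0 < beta a b := beta_pos ha hb
  have h1 : 0 < beta (a + p) (b + q) := beta_pos (by positivity) (by positivity)
  rw [integral_eq_lintegral_of_nonneg_ae]
  · rw [betaMeasure, lintegral_withDensity_eq_lintegral_mul _ (by unfold betaPDF; fun_prop)
      (by fun_prop)]
    have : ∀ x, (betaPDF a b * fun x => ENNReal.ofReal (x ^ p * (1 - x) ^ q)) x =
        ENNReal.ofReal (beta (a + p) (b + q) / beta a b) * betaPDF (a + p) (b + q) x := by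
      intro x
      simp only [Pi.mul_apply, betaPDF_eq]
      split_ifs with hx
      · have hx1 : 0 < 1 - x := by linarith [hx.2]
        rw [← ENNReal.ofReal_mul (by have := hx.1; positivity),
          ← ENNReal.ofReal_mul (by positivity)]
        congr 1
        rw [show a + p - 1 = (a - 1) + p by ring, show b + q - 1 = (b - 1) + q by ring,
          Real.rpow_add hx.1, Real.rpow_add hx1, Real.rpow_natCast, Real.rpow_natCast]
        field_simp
      · simp
    simp_rw [this]
    rw [lintegral_const_mul _ (by unfold betaPDF; fun_prop),
      lintegral_betaPDF_eq_one (by positivity) (by positivity), mul_one,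
      ENNReal.toReal_ofReal (by positivity)]
  · filter_upwards [ae_betaMeasure_mem_Ioo a b] with x hx
    have := hx.1
    have : 0 < 1 - x := by linarith [hx.2]
    simp only [Pi.zero_apply]
    positivity
  · exact Measurable.aestronglyMeasurable (by fun_prop)

lemma integral_pow_betaMeasure {a b : ℝ} (ha : 0 < a) (hb : 0 < b) (p : ℕ) :
    ∫ x, x ^ p ∂betaMeasure a b =
      (ascPochhammer ℝ p).eval a / (ascPochhammer ℝ p).eval (a + b) := by
  have h := integral_pow_mul_pow_betaMeasure ha hb p 0
  simp only [pow_zero, mul_one, Nat.cast_zero, add_zero] at h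
  rw [h, beta, beta, add_right_comm, Gamma_add_natCast ha, Gamma_add_natCast (add_pos ha hb)]
  have := Real.Gamma_pos_of_pos ha
  have := Real.Gamma_pos_of_pos hb
  have := Real.Gamma_pos_of_pos (add_pos ha hb)
  have := ascPochhammer_eval_pos (add_pos ha hb) p
  field_simp

lemma integral_one_sub_pow_betaMeasure {a b : ℝ} (ha : 0 < a) (hb : 0 < b) (p : ℕ) :
    ∫ x, (1 - x) ^ p ∂betaMeasure a b =
      (ascPochhammer ℝ p).eval b / (ascPochhammer ℝ p).eval (a + b) := by
  have h := integral_pow_mul_pow_betaMeasure ha hb 0 p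
  simp only [pow_zero, one_mul, Nat.cast_zero, add_zero] at h
  rw [h, beta, beta, ← add_assoc, Gamma_add_natCast hb, Gamma_add_natCast (add_pos ha hb)]
  have := Real.Gamma_pos_of_pos ha
  have := Real.Gamma_pos_of_pos hb
  have := Real.Gamma_pos_of_pos (add_pos ha hb)
  have := ascPochhammer_eval_pos (add_pos ha hb) p
  field_simp

/-! ### The binomial series -/

/-- The binomial series `(1 + z) ^ (-x) = ∑ (-1) ^ p x (x + 1) ⋯ (x + p - 1) / p! z ^ p`. -/
lemma hasSum_one_add_rpow_neg (x : ℝ) {z : ℝ} (hz : |z| < 1) :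
    HasSum (fun p : ℕ => (-z) ^ p / (p.factorial : ℝ) * (ascPochhammer ℝ p).eval x)
      ((1 + z) ^ (-x)) := by
  have h := (Real.one_div_one_sub_rpow_hasFPowerSeriesOnBall_zero x).hasSum (y := -z)
    (by simpa [Metric.mem_eball, edist_dist, Real.dist_eq] using hz)
  have hz' : 0 ≤ 1 + z := by linarith [(abs_lt.1 hz).1]
  rw [zero_add, sub_neg_eq_add, one_div, ← Real.rpow_neg hz'] at h
  have e : ∀ p : ℕ, (-z) ^ p / (p.factorial : ℝ) * (ascPochhammer ℝ p).eval x =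
      FormalMultilinearSeries.ofScalars ℝ (fun n => Ring.choose (x + n - 1) n) p fun _ => -z := by
    intro p
    have h2 := Ring.factorial_nsmul_multichoose_eq_ascPochhammer x p
    rw [Polynomial.ascPochhammer_smeval_eq_eval, nsmul_eq_mul] at h2
    rw [FormalMultilinearSeries.apply_eq_pow_smul_coeff, FormalMultilinearSeries.coeff_ofScalars,
      smul_eq_mul, Ring.choose, show x + p - 1 - p + 1 = x by ring, ← h2]
    field_simp
  simpa only [e] using h

/-! ### Rising factorials -/

lemma mul_ascPochhammer_add_one (x : ℝ) (p : ℕ) :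
    x * (ascPochhammer ℝ p).eval (x + 1) = (ascPochhammer ℝ p).eval x * (x + p) := by
  rw [← ascPochhammer_succ_eval, ascPochhammer_succ_left]
  simp [Polynomial.eval_comp]

lemma ascPochhammer_eval_mono {x y : ℝ} (hx : 0 ≤ x) (hxy : x ≤ y) (p : ℕ) :
    0 ≤ (ascPochhammer ℝ p).eval x ∧ (ascPochhammer ℝ p).eval x ≤ (ascPochhammer ℝ p).eval y := by
  induction p with
  | zero => simp
  | succ p ih =>
    simp only [ascPochhammer_succ_eval]
    have hp : (0 : ℝ) ≤ p := p.cast_nonneg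
    exact ⟨mul_nonneg ih.1 (by linarith),
      mul_le_mul ih.2 (by linarith) (by linarith) (ih.1.trans ih.2)⟩

lemma prod_one_add_div_eq_ascPochhammer_div {x : ℝ} (hx : 0 < x) (p r : ℕ) :
    ∏ i ∈ Finset.range r, (1 + (p : ℝ) / (x + i)) =
      (ascPochhammer ℝ p).eval (x + r) / (ascPochhammer ℝ p).eval x := by
  have h0 := ascPochhammer_eval_pos hx p
  induction r with
  | zero => simp [h0.ne']
  | succ r ih =>
    have hr : 0 < x + r := by positivity
    have h := mul_ascPochhammer_add_one (x + r) p
    rw [Finset.prod_range_succ, ih, Nat.cast_succ, ← add_assoc,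
      eq_div_of_mul_eq hr.ne' ((mul_comm _ _).trans h)]
    field_simp

/-! ### Expectations under a probability mass function -/

/-- The expectation of the nonnegative function `f` under the probability mass function `p`. -/
noncomputable def expect {β : Type*} (p : PMF β) (f : β → ENNReal) : ENNReal := ∑' a, p a * f a

lemma expect_congr {β : Type*} {p : PMF β} {f g : β → ENNReal}
    (h : ∀ a ∈ p.support, f a = g a) : expect p f = expect p g := by
  refine tsum_congr fun a => ?_
  by_cases ha : a ∈ p.support
  · rw [h a ha]
  · rw [(PMF.apply_eq_zero_iff p a).2 ha, zero_mul, zero_mul]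

lemma expect_const {β : Type*} (p : PMF β) (c : ENNReal) : expect p (fun _ => c) = c := by
  rw [expect, ENNReal.tsum_mul_right, p.tsum_coe, one_mul]

lemma expect_mul_const {β : Type*} (p : PMF β) (f : β → ENNReal) (c : ENNReal) :
    expect p (fun a => f a * c) = expect p f * c := by
  simp only [expect, ← mul_assoc, ENNReal.tsum_mul_right]

lemma expect_pure {β : Type*} (a : β) (f : β → ENNReal) : expect (PMF.pure a) f = f a := by
  rw [expect, tsum_eq_single a]
  · simp
  · intro b hb
    rw [PMF.pure_apply_of_ne _ _ hb, zero_mul]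

lemma expect_bind {β γ : Type*} (p : PMF β) (q : β → PMF γ) (f : γ → ENNReal) :
    expect (p.bind q) f = expect p fun a => expect (q a) f := by
  simp only [expect, PMF.bind_apply, ← ENNReal.tsum_mul_right, ← ENNReal.tsum_mul_left]
  rw [ENNReal.tsum_comm]
  simp only [mul_assoc]

lemma expect_map {β γ : Type*} (p : PMF β) (g : β → γ) (f : γ → ENNReal) :
    expect (p.map g) f = expect p fun a => f (g a) := by
  rw [PMF.map, expect_bind]
  simp only [Function.comp, expect_pure]

lemma expect_add_ite {β : Type*} [DecidableEq β] (p : PMF β) (a : β) (A B : ENNReal) :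
    expect p (fun b => B + if b = a then A else 0) = B + p a * A := by
  simp only [expect, mul_add]
  rw [ENNReal.tsum_add, ENNReal.tsum_mul_right, p.tsum_coe, one_mul, tsum_eq_single a]
  · simp
  · intro b hb
    simp [hb]

lemma integral_toMeasure_eq_toReal_expect {β : Type*} [Countable β] [MeasurableSpace β]
    [MeasurableSingletonClass β] (p : PMF β) {f : β → ℝ} (hf : ∀ a, 0 ≤ f a) :
    ∫ a, f a ∂p.toMeasure = (expect p fun a => ENNReal.ofReal (f a)).toReal := by
  rw [integral_eq_lintegral_of_nonneg_ae (Eventually.of_forall hf)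
    (measurable_of_countable f).aestronglyMeasurable, lintegral_countable']
  simp only [PMF.toMeasure_apply_singleton _ _ (measurableSet_singleton _), expect, mul_comm]

instance instCountableMultigraph : Countable Multigraph := Quotient.countable

/-! ### Factorial moments of the degrees -/

/-- The total weight `∑ (deg v + 2mu)` over the vertices `v = 1, …, n` of `G_n`. -/
noncomputable def totalWeight (m : ℕ) (α : ℝ) (n : ℕ) : ℝ :=
  2 * m * ((n : ℝ) - 1) + 2 * m * uParam α * n

/-- The weight `deg v + 2mu = m + 2mu` of a new vertex, which is the first parameter of the
distribution of `ψ_j`. -/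
noncomputable def newWeight (m : ℕ) (α : ℝ) : ℝ := m + 2 * m * uParam α

/-- The second parameter of the distribution of `ψ_j`, which is the weight of the vertices
`1, …, j - 1` in `G_j`. -/
noncomputable def oldWeight (m : ℕ) (α : ℝ) (j : ℕ) : ℝ :=
  (2 * (j : ℝ) - 3) * m + 2 * m * uParam α * ((j : ℝ) - 1)

lemma uParam_nonneg {α : ℝ} (h0 : 0 ≤ α) (h1 : α < 1) : 0 ≤ uParam α :=
  div_nonneg h0 (by linarith)

lemma newWeight_pos {m : ℕ} (hm : 1 ≤ m) {α : ℝ} (h0 : 0 ≤ α) (h1 : α < 1) :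
    0 < newWeight m α := by
  have := uParam_nonneg h0 h1
  have : (1 : ℝ) ≤ m := by exact_mod_cast hm
  unfold newWeight
  positivity

lemma oldWeight_pos {m : ℕ} (hm : 1 ≤ m) {α : ℝ} (h0 : 0 ≤ α) (h1 : α < 1) {j : ℕ} (hj : 2 ≤ j) :
    0 < oldWeight m α j := by
  have := uParam_nonneg h0 h1
  have : (1 : ℝ) ≤ m := by exact_mod_cast hm
  have hj' : (2 : ℝ) ≤ j := by exact_mod_cast hj
  have : 0 < (2 * (j : ℝ) - 3) * m := by nlinarith
  have : 0 ≤ 2 * m * uParam α * ((j : ℝ) - 1) := mul_nonneg (by positivity) (by linarith)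
  unfold oldWeight
  linarith

lemma newWeight_add_oldWeight (m : ℕ) (α : ℝ) (j : ℕ) :
    newWeight m α + oldWeight m α j = totalWeight m α j := by
  unfold newWeight oldWeight totalWeight
  ring

lemma totalWeight_add (m : ℕ) (α : ℝ) (j : ℕ) :
    totalWeight m α j + m = oldWeight m α (j + 1) := by
  unfold oldWeight totalWeight
  push_cast
  ring

lemma totalWeight_pos {m : ℕ} (hm : 1 ≤ m) {α : ℝ} (h0 : 0 ≤ α) (h1 : α < 1) {j : ℕ}
    (hj : 2 ≤ j) : 0 < totalWeight m α j := by
  rw [← newWeight_add_oldWeight]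
  exact add_pos (newWeight_pos hm h0 h1) (oldWeight_pos hm h0 h1 hj)

/-- The mixture of uniform and preferential attachment is attachment with probability proportional
to `deg + 2mu`. -/
lemma attachProb_eq {m : ℕ} (hm : 1 ≤ m) {α : ℝ} (h0 : 0 ≤ α) (h1 : α < 1) (n : ℕ)
    (G : Multigraph) (w : List ℕ) (k : ℕ) :
    attachProb m α (n + 3) G w k =
      ((deg G k + w.count k : ℕ) + 2 * m * uParam α) / (totalWeight m α (n + 2) + w.length) := by
  have hm' : (1 : ℝ) ≤ m := by exact_mod_cast hm
  have hn0 : (0 : ℝ) ≤ n := n.cast_nonneg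
  have hr0 : (0 : ℝ) ≤ w.length := w.length.cast_nonneg
  have hα : 0 < 1 - α := by linarith
  have hZ : 0 < 2 * (m : ℝ) * ((n : ℝ) + 3 - 2) + w.length := by nlinarith
  have hD : 0 < 2 * (m : ℝ) * ((n : ℝ) + 3 - 2) + 2 * m * α + (1 - α) * w.length := by
    have : 0 ≤ 2 * (m : ℝ) * α := by positivity
    have : 0 ≤ (1 - α) * w.length := mul_nonneg (by linarith) hr0
    nlinarith
  have hT : totalWeight m α (n + 2) + w.length =
      (2 * (m : ℝ) * ((n : ℝ) + 3 - 2) + 2 * m * α + (1 - α) * w.length) / (1 - α) := by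
    unfold totalWeight uParam
    push_cast
    field_simp
    ring
  have h1' : 1 - alphaTilde m α (n + 3) w.length =
      (1 - α) * (2 * (m : ℝ) * ((n : ℝ) + 3 - 2) + w.length) /
        (2 * (m : ℝ) * ((n : ℝ) + 3 - 2) + 2 * m * α + (1 - α) * w.length) := by
    unfold alphaTilde
    push_cast
    rw [eq_div_iff hD.ne', sub_mul, div_mul_cancel₀ _ hD.ne']
    ring
  unfold attachProb
  rw [h1', hT]
  unfold alphaTilde uParam
  push_cast
  have : (n : ℝ) + 3 - 1 ≠ 0 := by linarith
  generalize 2 * (m : ℝ) * ((n : ℝ) + 3 - 2) + w.length = Z at hZ ⊢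
  generalize 2 * (m : ℝ) * ((n : ℝ) + 3 - 2) + 2 * m * α + (1 - α) * w.length = D at hD ⊢
  field_simp
  ring

lemma attachLaw_apply {m : ℕ} (hm : 1 ≤ m) {α : ℝ} (h0 : 0 ≤ α) (h1 : α < 1) (n : ℕ)
    {G : Multigraph} (hG : G ∈ (graphLaw m α (n + 2)).support) {r : ℕ} {w : List ℕ}
    (hw : w ∈ (targetsLaw m α (n + 3) G r).support) {k : ℕ} (hk : k ∈ Finset.Icc 1 (n + 2)) :
    attachLaw m α (n + 3) G w k = ENNReal.ofReal (attachProb m α (n + 3) G w k) := by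
  rw [attachLaw, dif_pos (sum_attachProb_eq_one hm h0 h1 n hG hw).2, PMF.ofFinset_apply,
    if_pos (by simpa using hk)]

/-- One attachment step multiplies the expected rising factorial of the weight of a vertex by
`1 + p / (total weight)`. -/
lemma expect_attachLaw {m : ℕ} (hm : 1 ≤ m) {α : ℝ} (h0 : 0 ≤ α) (h1 : α < 1) (n : ℕ)
    {G : Multigraph} (hG : G ∈ (graphLaw m α (n + 2)).support) {r : ℕ} {w : List ℕ}
    (hw : w ∈ (targetsLaw m α (n + 3) G r).support) {k : ℕ} (hk : k ∈ Finset.Icc 1 (n + 2))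
    (p : ℕ) :
    expect (attachLaw m α (n + 3) G w) (fun v => ENNReal.ofReal
        ((ascPochhammer ℝ p).eval ((deg G k + (v :: w).count k : ℕ) + 2 * m * uParam α))) =
      ENNReal.ofReal
          ((ascPochhammer ℝ p).eval ((deg G k + w.count k : ℕ) + 2 * m * uParam α)) *
        ENNReal.ofReal (1 + p / (totalWeight m α (n + 2) + r)) := by
  have hu := uParam_nonneg h0 h1
  have hT := totalWeight_pos hm h0 h1 (j := n + 2) (by omega)
  have hlen : w.length = r := (targetsLaw_support (by omega) hw).1
  set x : ℝ := (deg G k + w.count k : ℕ) + 2 * m * uParam α with hx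
  have hx0 : 0 ≤ x := by positivity
  have hA := ascPochhammer_eval_mono hx0 (by linarith : x ≤ x + 1) p
  -- The weight `x` becomes `x + 1` if the edge goes to `k`, and is unchanged otherwise.
  have e : ∀ v, ENNReal.ofReal
        ((ascPochhammer ℝ p).eval ((deg G k + (v :: w).count k : ℕ) + 2 * m * uParam α)) =
      ENNReal.ofReal ((ascPochhammer ℝ p).eval x) + if v = k then
        ENNReal.ofReal ((ascPochhammer ℝ p).eval (x + 1) - (ascPochhammer ℝ p).eval x) else 0 := by
    intro v
    split_ifs with h
    · rw [← ENNReal.ofReal_add hA.1 (by linarith), h, List.count_cons_self]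
      congr 1
      rw [add_sub_cancel, hx]
      congr 1
      push_cast
      ring
    · rw [List.count_cons_of_ne (by simpa using h), add_zero]
  have hTr : 0 < totalWeight m α (n + 2) + r := by positivity
  simp only [e]
  rw [expect_add_ite, attachLaw_apply hm h0 h1 n hG hw hk, attachProb_eq hm h0 h1, hlen, ← hx,
    ← ENNReal.ofReal_mul (by positivity), ← ENNReal.ofReal_mul hA.1,
    ← ENNReal.ofReal_add hA.1 (mul_nonneg (by positivity) (by linarith))]
  congr 1
  have := mul_ascPochhammer_add_one x p
  field_simp
  linear_combination this

lemma expect_targetsLaw {m : ℕ} (hm : 1 ≤ m) {α : ℝ} (h0 : 0 ≤ α) (h1 : α < 1) (n : ℕ)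
    {G : Multigraph} (hG : G ∈ (graphLaw m α (n + 2)).support) {k : ℕ}
    (hk : k ∈ Finset.Icc 1 (n + 2)) (p r : ℕ) :
    expect (targetsLaw m α (n + 3) G r) (fun w => ENNReal.ofReal
        ((ascPochhammer ℝ p).eval ((deg G k + w.count k : ℕ) + 2 * m * uParam α))) =
      ENNReal.ofReal ((ascPochhammer ℝ p).eval (deg G k + 2 * m * uParam α)) *
        ENNReal.ofReal (∏ i ∈ Finset.range r, (1 + (p : ℝ) / (totalWeight m α (n + 2) + i))) := by
  have hT := totalWeight_pos hm h0 h1 (j := n + 2) (by omega)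
  induction r with
  | zero => simp [targetsLaw, expect_pure]
  | succ r ih =>
    simp only [targetsLaw, expect_bind, expect_map]
    rw [expect_congr fun w hw => expect_attachLaw hm h0 h1 n hG hw hk p, expect_mul_const, ih,
      mul_assoc, ← ENNReal.ofReal_mul (Finset.prod_nonneg fun i _ => by positivity),
      ← Finset.prod_range_succ]

lemma deg_addEdges_of_ne {n k : ℕ} (h : k ≠ n) (G : Multigraph) (w : List ℕ) :
    deg (addEdges n G w) k = deg G k + w.count k := by
  unfold deg addEdges
  rw [Multiset.countP_add, Multiset.countP_map, ← Multiset.coe_count, Multiset.count,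
    Multiset.countP_eq_card_filter _ (w : Multiset ℕ)]
  simp [h]

lemma deg_addEdges_self (n : ℕ) (G : Multigraph) (w : List ℕ) :
    deg (addEdges n G w) n = deg G n + w.length := by
  unfold deg addEdges
  rw [Multiset.countP_add, Multiset.countP_map]
  simp

lemma deg_graphLaw_self {m : ℕ} {α : ℝ} (n : ℕ) {G : Multigraph}
    (hG : G ∈ (graphLaw m α (n + 3)).support) : deg G (n + 3) = m := by
  simp only [graphLaw, PMF.mem_support_bind_iff, PMF.mem_support_map_iff] at hG
  obtain ⟨G', hG', w, hw, rfl⟩ := hG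
  have h : deg G' (n + 3) = 0 := by
    refine Multiset.countP_eq_zero.2 fun e he hc => ?_
    have := Finset.mem_Icc.1 (((graphLaw_support n hG').1 e he).2 _ hc)
    omega
  rw [deg_addEdges_self, h, zero_add, (targetsLaw_support (by omega) hw).1]

lemma deg_replicate {m k : ℕ} (h : k ∈ s(2, 1)) : deg (Multiset.replicate m s(2, 1)) k = m := by
  refine (Multiset.countP_eq_card.2 fun e he => ?_).trans (Multiset.card_replicate _ _)
  rwa [Multiset.eq_of_mem_replicate he]

/-- The `p`-th moment of `ψ_k * ∏_{j = k + 1}^n (1 - ψ_j)`. The vertex `k = 1` is separate because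
`ψ_1 = 1` is not Beta distributed. -/
noncomputable def strengthMoment (m : ℕ) (α : ℝ) (p k n : ℕ) : ℝ :=
  (if k = 1 then 1 else
    (ascPochhammer ℝ p).eval (newWeight m α) / (ascPochhammer ℝ p).eval (totalWeight m α k)) *
  ∏ j ∈ Finset.Icc (k + 1) n,
    (ascPochhammer ℝ p).eval (oldWeight m α j) / (ascPochhammer ℝ p).eval (totalWeight m α j)

/-- The rising factorial moments of the weight of the vertex `k` in `G_n` are those of a Pólya urn
of total weight `totalWeight m α n` in which the limiting proportion of `k` is distributed like
`ψ_k * ∏_{j = k + 1}^n (1 - ψ_j)`. -/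
lemma expect_graphLaw {m : ℕ} (hm : 1 ≤ m) {α : ℝ} (h0 : 0 ≤ α) (h1 : α < 1) {k : ℕ}
    (hk : 1 ≤ k) (p : ℕ) {n : ℕ} (hn : max k 2 ≤ n) :
    expect (graphLaw m α n) (fun G => ENNReal.ofReal
        ((ascPochhammer ℝ p).eval (deg G k + 2 * m * uParam α))) =
      ENNReal.ofReal ((ascPochhammer ℝ p).eval (totalWeight m α n) * strengthMoment m α p k n) := by
  have hT : ∀ {j : ℕ}, 2 ≤ j → 0 < (ascPochhammer ℝ p).eval (totalWeight m α j) := fun hj =>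
    ascPochhammer_eval_pos (totalWeight_pos hm h0 h1 hj) p
  have hO : ∀ {j : ℕ}, 2 ≤ j → 0 < (ascPochhammer ℝ p).eval (oldWeight m α j) := fun hj =>
    ascPochhammer_eval_pos (oldWeight_pos hm h0 h1 hj) p
  induction n, hn using Nat.le_induction with
  | base =>
    obtain rfl | hk2 := hk.eq_or_lt
    · have h2 := hT le_rfl
      have e : oldWeight m α 2 = m + 2 * m * uParam α := by unfold oldWeight; push_cast; ring
      rw [show max 1 2 = 2 from rfl]
      simp only [graphLaw, expect_pure, strengthMoment,
        if_true, one_mul, Nat.reduceAdd, Finset.Icc_self, Finset.prod_singleton]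
      rw [mul_div_cancel₀ _ h2.ne', e, deg_replicate (by simp)]
    · have hk2' : 2 ≤ k := hk2
      have h2 := hT hk2'
      rw [max_eq_left hk2', strengthMoment, if_neg (by omega), Finset.Icc_eq_empty (by omega),
        Finset.prod_empty, mul_one, mul_div_cancel₀ _ h2.ne', newWeight]
      obtain rfl | hk3 := hk2'.eq_or_lt
      · rw [graphLaw, expect_pure, deg_replicate (by simp)]
      · obtain ⟨l, rfl⟩ := Nat.exists_eq_add_of_le' (show 3 ≤ k by omega)
        rw [← expect_const (graphLaw m α (l + 3)) (ENNReal.ofReal _)]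
        exact expect_congr fun G hG => by rw [deg_graphLaw_self l hG]
  | succ n hn ih =>
    have hn2 : 2 ≤ n := le_of_max_le_right hn
    have hkn : k ≤ n := le_of_max_le_left hn
    obtain ⟨l, rfl⟩ := Nat.exists_eq_add_of_le' hn2
    have hW := totalWeight_pos hm h0 h1 hn2
    have e : ∀ G ∈ (graphLaw m α (l + 2)).support,
        expect (targetsLaw m α (l + 3) G m) (fun w => ENNReal.ofReal
          ((ascPochhammer ℝ p).eval (deg (addEdges (l + 3) G w) k + 2 * m * uParam α))) =
        ENNReal.ofReal ((ascPochhammer ℝ p).eval (deg G k + 2 * m * uParam α)) *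
          ENNReal.ofReal ((ascPochhammer ℝ p).eval (oldWeight m α (l + 3)) /
            (ascPochhammer ℝ p).eval (totalWeight m α (l + 2))) := by
      intro G hG
      simp only [deg_addEdges_of_ne (show k ≠ l + 3 by omega)]
      rw [expect_targetsLaw hm h0 h1 l hG (Finset.mem_Icc.2 ⟨hk, hkn⟩),
        prod_one_add_div_eq_ascPochhammer_div hW, totalWeight_add]
    have e1 := hT hn2
    have e2 := hO (j := l + 3) (by omega)
    have e3 := hT (j := l + 3) (by omega)
    rw [show l + 2 + 1 = l + 3 from rfl, graphLaw, expect_bind]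
    simp only [expect_map]
    rw [expect_congr e, expect_mul_const, ih, ← ENNReal.ofReal_mul' (by positivity)]
    congr 1
    have h3 := Finset.prod_Icc_succ_top (show k + 1 ≤ l + 2 + 1 by omega) fun j =>
      (ascPochhammer ℝ p).eval (oldWeight m α j) / (ascPochhammer ℝ p).eval (totalWeight m α j)
    rw [show l + 2 + 1 = l + 3 from rfl] at h3
    rw [strengthMoment, strengthMoment, h3]
    field_simp

/-! ### The parameters -/

lemma chi_eq {α : ℝ} (h1 : α < 1) : chi α = (1 + α) / 2 := by
  have : 1 - α ≠ 0 := by linarith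
  unfold chi uParam
  field_simp
  ring

lemma half_le_chi {α : ℝ} (h0 : 0 ≤ α) (h1 : α < 1) : 1 / 2 ≤ chi α := by
  rw [chi_eq h1]; linarith

lemma chi_lt_one {α : ℝ} (h1 : α < 1) : chi α < 1 := by
  rw [chi_eq h1]; linarith

lemma totalWeight_eq (m : ℕ) {α : ℝ} (h1 : α < 1) (n : ℕ) :
    totalWeight m α n = m / (1 - chi α) * (n - 2 * (1 - chi α)) := by
  have : 1 - α ≠ 0 := by linarith
  rw [chi_eq h1]
  rw [show 1 - (1 + α) / 2 = (1 - α) / 2 by ring]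
  unfold totalWeight uParam
  field_simp
  ring

lemma newWeight_eq (m : ℕ) {α : ℝ} (h1 : α < 1) :
    newWeight m α = m / (1 - chi α) * chi α := by
  have : 1 - α ≠ 0 := by linarith
  rw [chi_eq h1]
  rw [show 1 - (1 + α) / 2 = (1 - α) / 2 by ring]
  unfold newWeight uParam
  field_simp
  ring

lemma oldWeight_eq (m : ℕ) {α : ℝ} (h1 : α < 1) (n : ℕ) :
    oldWeight m α n = m / (1 - chi α) * (n - 2 * (1 - chi α) - chi α) := by
  have h := newWeight_add_oldWeight m α n
  rw [newWeight_eq m h1, totalWeight_eq m h1] at h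
  linear_combination h

/-! ### Normalised moments of the factors `1 - ψ_j` -/

/-- The `p`-th moment of `(j / (j - 1)) ^ χ * (1 - ψ_j)`. -/
noncomputable def factorMoment (m : ℕ) (α : ℝ) (p j : ℕ) : ℝ :=
  (((j : ℝ) / (j - 1)) ^ chi α) ^ p *
    ((ascPochhammer ℝ p).eval (oldWeight m α j) / (ascPochhammer ℝ p).eval (totalWeight m α j))

/-- Bernoulli's inequality, applied to `(1 + 1 / (j - 1)) ^ χ` and to `(1 - 1 / j) ^ χ`, encloses
the mean. -/
lemma abs_factorMoment_one_sub_one_le {m : ℕ} (hm : 1 ≤ m) {α : ℝ} (h0 : 0 ≤ α) (h1 : α < 1)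
    {j : ℕ} (hj : 2 ≤ j) : |factorMoment m α 1 j - 1| ≤ 4 * ((j : ℝ) ^ 2)⁻¹ := by
  have hχ0 := half_le_chi h0 h1
  have hχ1 := chi_lt_one h1
  have hj' : (2 : ℝ) ≤ j := by exact_mod_cast hj
  have hm' : (1 : ℝ) ≤ m := by exact_mod_cast hm
  have hA : 0 < (m : ℝ) / (1 - chi α) := div_pos (by linarith) (by linarith)
  have e : factorMoment m α 1 j =
      ((j : ℝ) / (j - 1)) ^ chi α * (1 - chi α / (j - 2 * (1 - chi α))) := by
    unfold factorMoment
    rw [pow_one, ascPochhammer_one, Polynomial.eval_X, Polynomial.eval_X, oldWeight_eq m h1,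
      totalWeight_eq m h1, mul_div_mul_left _ _ hA.ne']
    congr 1
    rw [sub_div, div_self (by linarith)]
  rw [e]
  generalize chi α = χ at *
  have hd : 0 < (j : ℝ) - 2 * (1 - χ) := by linarith
  have hj1 : 0 < (j : ℝ) - 1 := by linarith
  have hy : (j : ℝ) / (j - 1) = 1 + 1 / (j - 1) := by field_simp; ring
  have hup : ((j : ℝ) / (j - 1)) ^ χ ≤ 1 + χ * (1 / (j - 1)) := by
    rw [hy]
    exact rpow_one_add_le_one_add_mul_self
      (le_trans (by norm_num) (by positivity : (0 : ℝ) ≤ 1 / (j - 1))) (by linarith) hχ1.le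
  have hlow : 1 / (1 - χ / j) ≤ ((j : ℝ) / (j - 1)) ^ χ := by
    have h := rpow_one_add_le_one_add_mul_self (s := -(1 / (j : ℝ))) (p := χ)
      (by rw [neg_le_neg_iff, div_le_one (by linarith)]; linarith) (by linarith) hχ1.le
    have hx : 1 + -(1 / (j : ℝ)) = ((j : ℝ) / (j - 1))⁻¹ := by field_simp; ring
    rw [hx, Real.inv_rpow (by positivity)] at h
    have h2 : 0 < ((j : ℝ) / (j - 1)) ^ χ := by positivity
    rw [one_div, inv_le_comm₀ _ h2]
    · exact h.trans (le_of_eq (by ring))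
    · rw [sub_pos, div_lt_one (by linarith)]; linarith
  have hq : 0 ≤ 1 - χ / (j - 2 * (1 - χ)) := by
    rw [sub_nonneg, div_le_one hd]; linarith
  have hb : 1 / ((j : ℝ) - 1) ^ 2 ≤ 4 * ((j : ℝ) ^ 2)⁻¹ := by
    rw [← div_eq_mul_inv, div_le_div_iff₀ (by positivity) (by positivity)]
    nlinarith
  refine (abs_le.2 ⟨?_, ?_⟩).trans hb
  · have h2 : 1 / (1 - χ / j) * (1 - χ / (j - 2 * (1 - χ))) ≤
        ((j : ℝ) / (j - 1)) ^ χ * (1 - χ / (j - 2 * (1 - χ))) :=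
      mul_le_mul_of_nonneg_right hlow hq
    have h3 : 1 / (1 - χ / j) * (1 - χ / (j - 2 * (1 - χ))) =
        1 - χ * (2 * (1 - χ)) / ((j - χ) * (j - 2 * (1 - χ))) := by
      have : (j : ℝ) - χ ≠ 0 := by linarith
      field_simp
      ring
    have h4 : χ * (2 * (1 - χ)) / ((j - χ) * (j - 2 * (1 - χ))) ≤ 1 / ((j : ℝ) - 1) ^ 2 := by
      refine div_le_div₀ zero_le_one (by nlinarith) (by positivity) ?_
      rw [sq]
      exact mul_le_mul (by linarith) (by linarith) hj1.le (by linarith)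
    linarith
  · have h2 : ((j : ℝ) / (j - 1)) ^ χ * (1 - χ / (j - 2 * (1 - χ))) ≤
        (1 + χ * (1 / (j - 1))) * (1 - χ / (j - 2 * (1 - χ))) :=
      mul_le_mul_of_nonneg_right hup hq
    have h3 : (1 + χ * (1 / (j - 1))) * (1 - χ / (j - 2 * (1 - χ))) =
        1 + χ * (1 - 2 * (1 - χ) - χ) / ((j - 1) * (j - 2 * (1 - χ))) := by
      field_simp
      ring
    have h4 : χ * (1 - 2 * (1 - χ) - χ) / ((j - 1) * (j - 2 * (1 - χ))) ≤ 0 :=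
      div_nonpos_of_nonpos_of_nonneg (by nlinarith) (by positivity)
    have : 0 ≤ 1 / ((j : ℝ) - 1) ^ 2 := by positivity
    linarith

lemma abs_factorMoment_two_sub_one_le {m : ℕ} (hm : 1 ≤ m) {α : ℝ} (h0 : 0 ≤ α) (h1 : α < 1)
    {j : ℕ} (hj : 2 ≤ j) : |factorMoment m α 2 j - 1| ≤ 44 * ((j : ℝ) ^ 2)⁻¹ := by
  have hχ0 := half_le_chi h0 h1
  have hχ1 := chi_lt_one h1
  have hj' : (2 : ℝ) ≤ j := by exact_mod_cast hj
  have hm' : (1 : ℝ) ≤ m := by exact_mod_cast hm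
  have hA : 1 ≤ (m : ℝ) / (1 - chi α) := by rw [le_div_iff₀ (by linarith)]; linarith
  have hO := oldWeight_pos hm h0 h1 hj
  have hT := totalWeight_pos hm h0 h1 hj
  have ha := newWeight_pos hm h0 h1
  have hF := abs_factorMoment_one_sub_one_le hm h0 h1 hj
  have hsq : 4 * ((j : ℝ) ^ 2)⁻¹ ≤ 1 := by
    rw [← div_eq_mul_inv, div_le_one (by positivity)]; nlinarith
  have e : factorMoment m α 2 j = factorMoment m α 1 j ^ 2 *
      (1 + newWeight m α / (oldWeight m α j * (totalWeight m α j + 1))) := by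
    have h := newWeight_add_oldWeight m α j
    have h2 : ∀ x : ℝ, (ascPochhammer ℝ 2).eval x = x * (x + 1) := fun x => by
      rw [ascPochhammer_succ_eval, ascPochhammer_one, Polynomial.eval_X, Nat.cast_one]
    simp only [factorMoment, h2, ascPochhammer_one, Polynomial.eval_X, pow_one]
    rw [eq_sub_of_add_eq h]
    generalize ((j : ℝ) / (j - 1)) ^ chi α = y
    generalize totalWeight m α j = T at hT ⊢
    generalize oldWeight m α j = b at hO ⊢
    have e2 : 1 + (T - b) / (b * (T + 1)) = T * (b + 1) / (b * (T + 1)) := by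
      field_simp
      ring
    rw [e2, mul_pow, div_pow, mul_assoc]
    field_simp
  have hε : newWeight m α / (oldWeight m α j * (totalWeight m α j + 1)) ≤
      8 * ((j : ℝ) ^ 2)⁻¹ := by
    rw [newWeight_eq m h1, oldWeight_eq m h1, totalWeight_eq m h1]
    generalize (m : ℝ) / (1 - chi α) = A at *
    have hd : 0 < (j : ℝ) - 2 * (1 - chi α) - chi α := by linarith
    have hd' : 0 ≤ (j : ℝ) - 2 * (1 - chi α) := by linarith
    rw [mul_assoc A, mul_div_mul_left _ _ (by linarith : A ≠ 0), ← div_eq_mul_inv,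
      div_le_div_iff₀ (by positivity) (by positivity)]
    have h2 : (j : ℝ) / 4 * (j / 2) ≤
        (j - 2 * (1 - chi α) - chi α) * (A * (j - 2 * (1 - chi α)) + 1) := by
      refine mul_le_mul (by linarith) ?_ (by positivity) hd.le
      nlinarith
    nlinarith
  have hε0 : 0 ≤ newWeight m α / (oldWeight m α j * (totalWeight m α j + 1)) := by positivity
  rw [e]
  generalize factorMoment m α 1 j = f at *
  generalize newWeight m α / (oldWeight m α j * (totalWeight m α j + 1)) = ε at *
  generalize ((j : ℝ) ^ 2)⁻¹ = x at *
  obtain ⟨h2, h3⟩ := abs_le.1 hF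
  have hf0 : 0 ≤ f := by linarith
  have hf2 : f ≤ 2 := by linarith
  rw [abs_le]
  constructor
  · nlinarith [mul_nonneg (sq_nonneg f) hε0]
  · have : f ^ 2 * ε ≤ 4 * (8 * x) := mul_le_mul (by nlinarith) hε hε0 (by norm_num)
    nlinarith

/-- A product of factors `1 + O(j ^ (-2))` over `j > k` is `1 + O(k ^ (-1))`. -/
lemma abs_prod_sub_one_le {q : ℕ → ℝ} {C : ℝ} (hC : 0 ≤ C)
    (hq : ∀ j, 2 ≤ j → |q j - 1| ≤ C * ((j : ℝ) ^ 2)⁻¹) {k l : ℕ} (hk : 1 ≤ k) (hkl : k ≤ l) :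
    |∏ j ∈ Finset.Icc (k + 1) l, q j - 1| ≤ C * Real.exp C / k := by
  have hk' : (1 : ℝ) ≤ k := by exact_mod_cast hk
  have h1 := Finset.norm_prod_one_add_sub_one_le (Finset.Icc (k + 1) l) fun j => q j - 1
  simp only [add_sub_cancel, Real.norm_eq_abs] at h1
  have h2 : ∑ j ∈ Finset.Icc (k + 1) l, |q j - 1| ≤ C / k := by
    calc ∑ j ∈ Finset.Icc (k + 1) l, |q j - 1|
        ≤ ∑ j ∈ Finset.Icc (k + 1) l, C * ((j : ℝ) ^ 2)⁻¹ :=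
          Finset.sum_le_sum fun j hj => hq j (by have := Finset.mem_Icc.1 hj; omega)
      _ = C * ∑ j ∈ Finset.Ioc k l, ((j : ℝ) ^ 2)⁻¹ := by
          rw [← Finset.mul_sum, Finset.Icc_add_one_left_eq_Ioc]
      _ ≤ C * ((k : ℝ)⁻¹ - (l : ℝ)⁻¹) :=
          mul_le_mul_of_nonneg_left (sum_Ioc_inv_sq_le_sub (by omega) hkl) hC
      _ ≤ C / k := by
          rw [div_eq_mul_inv]
          exact mul_le_mul_of_nonneg_left (sub_le_self _ (by positivity)) hC
  have h3 : C / k ≤ C := div_le_self hC hk'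
  have h4 : 0 ≤ C / k := by positivity
  calc _ ≤ Real.exp (C / k) - 1 := h1.trans (sub_le_sub_right (Real.exp_le_exp.2 h2) _)
    _ ≤ C / k * Real.exp (C / k) := by
        have := Real.add_one_le_exp (-(C / k))
        rw [Real.exp_neg] at this
        have h5 := Real.exp_pos (C / k)
        have := mul_le_mul_of_nonneg_right this h5.le
        rw [inv_mul_cancel₀ h5.ne'] at this
        linarith
    _ ≤ C / k * Real.exp C := mul_le_mul_of_nonneg_left (Real.exp_le_exp.2 h3) h4
    _ = C * Real.exp C / k := by ring

lemma prod_div_sub_one {k l : ℕ} (hk : 1 ≤ k) (hkl : k ≤ l) :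
    ∏ j ∈ Finset.Icc (k + 1) l, ((j : ℝ) / (j - 1)) = l / k := by
  have hk' : (k : ℝ) ≠ 0 := by positivity
  induction l, hkl using Nat.le_induction with
  | base => simp [hk']
  | succ l hl ih =>
    have hl' : (l : ℝ) ≠ 0 := by have : 1 ≤ l := hk.trans hl; positivity
    rw [Finset.prod_Icc_succ_top (by omega), ih]
    push_cast
    rw [add_sub_cancel_right]
    field_simp

/-! ### Moments of the products of the strengths -/

lemma partialF_eq_prod {Ω : Type*} {ψ : ℕ → Ω → ℝ} {α : ℝ} {k l : ℕ} (hk : 1 ≤ k)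
    (hkl : k ≤ l) (ω : Ω) :
    partialF α ψ k l ω =
      ∏ j ∈ Finset.Icc (k + 1) l, (((j : ℝ) / (j - 1)) ^ chi α * (1 - ψ j ω)) := by
  rw [partialF, Finset.prod_mul_distrib, Real.finsetProd_rpow, prod_div_sub_one hk hkl]
  intro j hj
  have : 2 ≤ j := by have := Finset.mem_Icc.1 hj; omega
  have : (2 : ℝ) ≤ j := by exact_mod_cast this
  exact div_nonneg (by linarith) (by linarith)

lemma partialF_mul_partialF {Ω : Type*} {ψ : ℕ → Ω → ℝ} {α : ℝ} {k n l : ℕ} (hk : 1 ≤ k)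
    (hkn : k ≤ n) (hnl : n ≤ l) (ω : Ω) :
    partialF α ψ k n ω * partialF α ψ n l ω = partialF α ψ k l ω := by
  rw [partialF_eq_prod hk hkn, partialF_eq_prod (hk.trans hkn) hnl,
    partialF_eq_prod hk (hkn.trans hnl)]
  simp only [Finset.Icc_add_one_left_eq_Ioc]
  exact Finset.prod_Ioc_consecutive _ hkn hnl

lemma partialF_self {Ω : Type*} {ψ : ℕ → Ω → ℝ} {α : ℝ} {k : ℕ} (hk : 1 ≤ k)
    (ω : Ω) : partialF α ψ k k ω = 1 := by
  rw [partialF_eq_prod hk le_rfl, Finset.Icc_eq_empty (by omega), Finset.prod_empty]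

/-- The proportion `ψ_k * ∏_{j = k + 1}^n (1 - ψ_j)` of the vertex `k` in the urn with `n`
colours. -/
noncomputable def strength {Ω : Type*} (ψ : ℕ → Ω → ℝ) (k n : ℕ) (ω : Ω) : ℝ :=
  ψ k ω * ∏ j ∈ Finset.Icc (k + 1) n, (1 - ψ j ω)

section Strengths

variable {Ω : Type*} [MeasurableSpace Ω] {P : Measure Ω} {ψ : ℕ → Ω → ℝ} {m : ℕ} {α : ℝ}

lemma IsPolyaStrengths.hasLaw (hψ : IsPolyaStrengths m α ψ P) {j : ℕ} (hj : 2 ≤ j) :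
    HasLaw (ψ j) (betaMeasure (newWeight m α) (oldWeight m α j)) P :=
  hψ.law j hj

lemma IsPolyaStrengths.aemeasurable (hψ : IsPolyaStrengths m α ψ P) {j : ℕ} (hj : 1 ≤ j) :
    AEMeasurable (ψ j) P := by
  obtain rfl | hj := hj.eq_or_lt
  · exact aemeasurable_const.congr (hψ.one.mono fun ω h => h.symm)
  · exact (hψ.hasLaw hj).aemeasurable

lemma IsPolyaStrengths.ae_mem_Ioo (hψ : IsPolyaStrengths m α ψ P) :
    ∀ᵐ ω ∂P, ∀ j, 2 ≤ j → ψ j ω ∈ Set.Ioo (0 : ℝ) 1 := by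
  refine ae_all_iff.2 fun j => ?_
  by_cases hj : 2 ≤ j
  · filter_upwards [((hψ.hasLaw hj).ae_iff (p := fun x => x ∈ Set.Ioo (0 : ℝ) 1)
      (measurableSet_setOfPred.1 measurableSet_Ioo)).2 (ae_betaMeasure_mem_Ioo _ _)] with ω h _
      using h
  · exact Eventually.of_forall fun ω h => absurd h hj

lemma IsPolyaStrengths.ae_mem_Ioc (hψ : IsPolyaStrengths m α ψ P) {k : ℕ} (hk : 1 ≤ k) :
    ∀ᵐ ω ∂P, ψ k ω ∈ Set.Ioc (0 : ℝ) 1 := by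
  filter_upwards [hψ.one, hψ.ae_mem_Ioo] with ω h1 h2
  obtain rfl | hk := hk.eq_or_lt
  · simp [h1]
  · exact Set.Ioo_subset_Ioc_self (h2 k hk)

lemma IsPolyaStrengths.aemeasurable_strength (hψ : IsPolyaStrengths m α ψ P) {k : ℕ} (hk : 1 ≤ k)
    (n : ℕ) : AEMeasurable (strength ψ k n) P := by
  unfold strength
  refine (hψ.aemeasurable hk).mul (Finset.aemeasurable_fun_prod _ fun j hj => ?_)
  exact (hψ.aemeasurable (by have := Finset.mem_Icc.1 hj; omega)).const_sub 1

lemma IsPolyaStrengths.ae_strength_mem (hψ : IsPolyaStrengths m α ψ P) {k : ℕ} (hk : 1 ≤ k) :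
    ∀ᵐ ω ∂P, ∀ n, strength ψ k n ω ∈ Set.Icc (0 : ℝ) 1 := by
  filter_upwards [hψ.ae_mem_Ioo, hψ.ae_mem_Ioc hk] with ω h h2 n
  have hI : ∀ j ∈ Finset.Icc (k + 1) n, 0 ≤ 1 - ψ j ω ∧ 1 - ψ j ω ≤ 1 := fun j hj => by
    have := h j (by have := Finset.mem_Icc.1 hj; omega)
    exact ⟨by linarith [this.2], by linarith [this.1]⟩
  have h3 := Finset.prod_nonneg fun j hj => (hI j hj).1
  have h4 := Finset.prod_le_one (fun j hj => (hI j hj).1) fun j hj => (hI j hj).2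
  exact ⟨mul_nonneg h2.1.le h3, mul_le_one₀ h2.2 h3 h4⟩

lemma IsPolyaStrengths.integral_prod (hψ : IsPolyaStrengths m α ψ P) {s : Finset ℕ}
    (hs : ∀ j ∈ s, 2 ≤ j) {g : ℕ → ℝ → ℝ} (hg : ∀ j, Measurable (g j)) :
    ∫ ω, ∏ j ∈ s, g j (ψ j ω) ∂P = ∏ j ∈ s, ∫ ω, g j (ψ j ω) ∂P := by
  have hinj : Function.Injective fun j : s => (j : ℕ) - 2 := by
    intro i j hij
    have hi := hs _ i.2
    have hj := hs _ j.2
    simp only at hij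
    exact Subtype.ext (by omega)
  have h := (hψ.indep.precomp hinj).integral_fun_prod_comp (f := fun j : s => g j)
    (fun j => hψ.aemeasurable (by omega)) (fun j => (hg j).aestronglyMeasurable)
  have e : ∀ j : s, (j : ℕ) - 2 + 2 = j := fun j => by have := hs _ j.2; omega
  simp only [e] at h
  rw [← Finset.prod_coe_sort]
  simpa only [← Finset.prod_coe_sort s] using h

lemma IsPolyaStrengths.integral_one_sub_pow (hm : 1 ≤ m) (h0 : 0 ≤ α) (h1 : α < 1)
    (hψ : IsPolyaStrengths m α ψ P) {j : ℕ} (hj : 2 ≤ j) (p : ℕ) :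
    ∫ ω, (1 - ψ j ω) ^ p ∂P =
      (ascPochhammer ℝ p).eval (oldWeight m α j) / (ascPochhammer ℝ p).eval (totalWeight m α j) := by
  rw [← newWeight_add_oldWeight, ← integral_one_sub_pow_betaMeasure (newWeight_pos hm h0 h1)
    (oldWeight_pos hm h0 h1 hj), ← (hψ.hasLaw hj).map_eq,
    integral_map (hψ.aemeasurable (by omega)) (by fun_prop)]

lemma IsPolyaStrengths.integral_pow (hm : 1 ≤ m) (h0 : 0 ≤ α) (h1 : α < 1)
    (hψ : IsPolyaStrengths m α ψ P) {j : ℕ} (hj : 2 ≤ j) (p : ℕ) :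
    ∫ ω, ψ j ω ^ p ∂P =
      (ascPochhammer ℝ p).eval (newWeight m α) / (ascPochhammer ℝ p).eval (totalWeight m α j) := by
  rw [← newWeight_add_oldWeight, ← integral_pow_betaMeasure (newWeight_pos hm h0 h1)
    (oldWeight_pos hm h0 h1 hj), ← (hψ.hasLaw hj).map_eq,
    integral_map (hψ.aemeasurable (by omega)) (by fun_prop)]

lemma IsPolyaStrengths.integral_strength [IsProbabilityMeasure P] (hm : 1 ≤ m) (h0 : 0 ≤ α)
    (h1 : α < 1) (hψ : IsPolyaStrengths m α ψ P) {k : ℕ} (hk : 1 ≤ k) (p n : ℕ) :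
    ∫ ω, strength ψ k n ω ^ p ∂P = strengthMoment m α p k n := by
  have hI : ∀ j ∈ Finset.Icc (k + 1) n, 2 ≤ j := fun j hj => by
    have := Finset.mem_Icc.1 hj; omega
  have hprod : ∏ j ∈ Finset.Icc (k + 1) n, ∫ ω, (1 - ψ j ω) ^ p ∂P =
      ∏ j ∈ Finset.Icc (k + 1) n, (ascPochhammer ℝ p).eval (oldWeight m α j) /
        (ascPochhammer ℝ p).eval (totalWeight m α j) :=
    Finset.prod_congr rfl fun j hj => hψ.integral_one_sub_pow hm h0 h1 (hI j hj) p
  unfold strengthMoment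
  rw [← hprod]
  simp only [strength, mul_pow, ← Finset.prod_pow]
  obtain rfl | hk2 := hk.eq_or_lt
  · rw [if_pos rfl, one_mul, ← hψ.integral_prod hI (g := fun _ x => (1 - x) ^ p)
      (fun j => by fun_prop)]
    refine integral_congr_ae (hψ.one.mono fun ω h => ?_)
    simp only [h, one_pow, one_mul]
  · have hnot : k ∉ Finset.Icc (k + 1) n := by simp
    have h := hψ.integral_prod (s := insert k (Finset.Icc (k + 1) n))
      (g := fun j x => if j = k then x ^ p else (1 - x) ^ p)
      (by
        intro j hj
        obtain rfl | hj := Finset.mem_insert.1 hj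
        · exact hk2
        · exact hI j hj)
      (fun j => by split_ifs <;> fun_prop)
    have hne : ∀ j ∈ Finset.Icc (k + 1) n, j ≠ k := fun j hj => by
      have := Finset.mem_Icc.1 hj; omega
    simp only [Finset.prod_insert hnot, if_true] at h
    rw [if_neg (by omega), ← hψ.integral_pow hm h0 h1 hk2]
    refine Eq.trans (integral_congr_ae (Eventually.of_forall fun ω => ?_))
      (h.trans ?_)
    · exact congrArg (ψ k ω ^ p * ·) (Finset.prod_congr rfl fun j hj => (if_neg (hne j hj)).symm)
    · congr 1
      exact Finset.prod_congr rfl fun j hj => by simp only [if_neg (hne j hj)]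

lemma IsPolyaStrengths.aestronglyMeasurable_partialF (hψ : IsPolyaStrengths m α ψ P) (k l : ℕ) :
    AEStronglyMeasurable (partialF α ψ k l) P := by
  unfold partialF
  refine AEMeasurable.aestronglyMeasurable (AEMeasurable.const_mul ?_ _)
  refine Finset.aemeasurable_fun_prod _ fun j hj => ?_
  exact (hψ.aemeasurable (by have := Finset.mem_Icc.1 hj; omega)).const_sub 1

lemma IsPolyaStrengths.ae_partialF_mem (hψ : IsPolyaStrengths m α ψ P) {k : ℕ} (hk : 1 ≤ k)
    (l : ℕ) : ∀ᵐ ω ∂P, 0 ≤ partialF α ψ k l ω ∧ partialF α ψ k l ω ≤ ((l : ℝ) / k) ^ chi α := by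
  filter_upwards [hψ.ae_mem_Ioo] with ω h
  have hI : ∀ j ∈ Finset.Icc (k + 1) l, 0 ≤ 1 - ψ j ω ∧ 1 - ψ j ω ≤ 1 := fun j hj => by
    have := h j (by have := Finset.mem_Icc.1 hj; omega)
    exact ⟨by linarith [this.2], by linarith [this.1]⟩
  have h0 : 0 ≤ ((l : ℝ) / k) ^ chi α := by positivity
  exact ⟨mul_nonneg h0 (Finset.prod_nonneg fun j hj => (hI j hj).1),
    mul_le_of_le_one_right h0 (Finset.prod_le_one (fun j hj => (hI j hj).1)
      fun j hj => (hI j hj).2)⟩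

lemma IsPolyaStrengths.memLp_partialF [IsFiniteMeasure P] (hψ : IsPolyaStrengths m α ψ P) {k : ℕ}
    (hk : 1 ≤ k) (l : ℕ) (p : ENNReal) : MemLp (partialF α ψ k l) p P := by
  refine MemLp.of_bound (hψ.aestronglyMeasurable_partialF k l) (((l : ℝ) / k) ^ chi α) ?_
  filter_upwards [hψ.ae_partialF_mem hk l] with ω h
  rw [Real.norm_eq_abs, abs_of_nonneg h.1]
  exact h.2

/-- Independence turns mixed moments of `F_{k, n}` and `F_{n, l}` into products. -/
lemma IsPolyaStrengths.integral_partialF_pow_mul_pow (hm : 1 ≤ m) (h0 : 0 ≤ α) (h1 : α < 1)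
    (hψ : IsPolyaStrengths m α ψ P) {k n l : ℕ} (hk : 1 ≤ k) (hkn : k ≤ n) (hnl : n ≤ l)
    (p q : ℕ) :
    ∫ ω, partialF α ψ k n ω ^ p * partialF α ψ n l ω ^ q ∂P =
      (∏ j ∈ Finset.Icc (k + 1) n, factorMoment m α p j) *
        ∏ j ∈ Finset.Icc (n + 1) l, factorMoment m α q j := by
  have hfac : ∀ (p : ℕ) {j : ℕ}, 2 ≤ j →
      factorMoment m α p j = ∫ ω, (((j : ℝ) / (j - 1)) ^ chi α * (1 - ψ j ω)) ^ p ∂P := by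
    intro p j hj
    simp only [mul_pow]
    rw [integral_const_mul, hψ.integral_one_sub_pow hm h0 h1 hj, factorMoment]
  have hle : ∀ j ∈ Finset.Ioc k n, j ≤ n := fun j hj => (Finset.mem_Ioc.1 hj).2
  have hgt : ∀ j ∈ Finset.Ioc n l, ¬ j ≤ n := fun j hj => by
    have := (Finset.mem_Ioc.1 hj).1; omega
  have h := hψ.integral_prod (s := Finset.Ioc k l)
    (g := fun j x => if j ≤ n then (((j : ℝ) / (j - 1)) ^ chi α * (1 - x)) ^ p
      else (((j : ℝ) / (j - 1)) ^ chi α * (1 - x)) ^ q)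
    (fun j hj => by have := Finset.mem_Ioc.1 hj; omega) (fun j => by split_ifs <;> fun_prop)
  simp only [← Finset.prod_Ioc_consecutive _ hkn hnl] at h
  simp only [partialF_eq_prod hk hkn, partialF_eq_prod (hk.trans hkn) hnl, ← Finset.prod_pow,
    Finset.Icc_add_one_left_eq_Ioc]
  refine Eq.trans (integral_congr_ae (Eventually.of_forall fun ω => ?_)) (h.trans ?_)
  · refine congrArg₂ (· * ·) (Finset.prod_congr rfl fun j hj => (if_pos (hle j hj)).symm)
      (Finset.prod_congr rfl fun j hj => (if_neg (hgt j hj)).symm)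
  · refine congrArg₂ (· * ·) (Finset.prod_congr rfl fun j hj => ?_)
      (Finset.prod_congr rfl fun j hj => ?_)
    · rw [hfac p (by have := Finset.mem_Ioc.1 hj; omega)]
      simp only [if_pos (hle j hj)]
    · rw [hfac q (by have := Finset.mem_Ioc.1 hj; omega)]
      simp only [if_neg (hgt j hj)]

lemma IsPolyaStrengths.integral_partialF (hm : 1 ≤ m) (h0 : 0 ≤ α) (h1 : α < 1)
    (hψ : IsPolyaStrengths m α ψ P) {k l : ℕ} (hk : 1 ≤ k) (hkl : k ≤ l) :
    ∫ ω, partialF α ψ k l ω ∂P = ∏ j ∈ Finset.Icc (k + 1) l, factorMoment m α 1 j := by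
  have h := hψ.integral_partialF_pow_mul_pow hm h0 h1 hk le_rfl hkl 0 1
  simpa [Finset.Icc_eq_empty (show ¬ k + 1 ≤ k by omega)] using h

/-- The constant in the error terms `O(k ^ (-1))`. -/
noncomputable def errConst : ℝ := 44 * Real.exp 44

lemma errConst_pos : 0 < errConst := by unfold errConst; positivity

lemma IsPolyaStrengths.abs_integral_partialF_sub_one_le (hm : 1 ≤ m) (h0 : 0 ≤ α) (h1 : α < 1)
    (hψ : IsPolyaStrengths m α ψ P) {k l : ℕ} (hk : 1 ≤ k) (hkl : k ≤ l) :
    |∫ ω, partialF α ψ k l ω ∂P - 1| ≤ errConst / k := by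
  rw [hψ.integral_partialF hm h0 h1 hk hkl]
  refine abs_prod_sub_one_le (by norm_num) (fun j hj => ?_) hk hkl
  refine (abs_factorMoment_one_sub_one_le hm h0 h1 hj).trans ?_
  gcongr
  norm_num

/-- The increments of `F_{k, l}` in `l` are small in `L²`, uniformly in `k`. -/
lemma IsPolyaStrengths.integral_sq_partialF_sub_le [IsProbabilityMeasure P] (hm : 1 ≤ m)
    (h0 : 0 ≤ α) (h1 : α < 1) (hψ : IsPolyaStrengths m α ψ P) {k n l : ℕ} (hk : 1 ≤ k)
    (hkn : k ≤ n) (hnl : n ≤ l) :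
    ∫ ω, (partialF α ψ k l ω - partialF α ψ k n ω) ^ 2 ∂P ≤
      3 * (1 + errConst) * errConst / n := by
  have hn : 1 ≤ n := hk.trans hkn
  have hn0 : (0 : ℝ) < n := by exact_mod_cast hn
  have hk0 : (1 : ℝ) ≤ k := by exact_mod_cast hk
  have hint : ∀ q : ℕ, Integrable
      (fun ω => partialF α ψ k n ω ^ 2 * partialF α ψ n l ω ^ q) P := by
    intro q
    refine Integrable.of_bound (C := (((n : ℝ) / k) ^ chi α) ^ 2 * (((l : ℝ) / n) ^ chi α) ^ q)
      (((hψ.aestronglyMeasurable_partialF k n).pow 2).mul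
        ((hψ.aestronglyMeasurable_partialF n l).pow q)) ?_
    filter_upwards [hψ.ae_partialF_mem hk n, hψ.ae_partialF_mem hn l] with ω h2 h3
    have := h2.1
    have := h3.1
    rw [Real.norm_eq_abs, abs_of_nonneg (by positivity)]
    gcongr
    · exact h2.2
    · exact h3.2
  have e : ∀ ω, (partialF α ψ k l ω - partialF α ψ k n ω) ^ 2 =
      partialF α ψ k n ω ^ 2 * partialF α ψ n l ω ^ 2 -
        2 * (partialF α ψ k n ω ^ 2 * partialF α ψ n l ω ^ 1) +
        partialF α ψ k n ω ^ 2 * partialF α ψ n l ω ^ 0 := fun ω => by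
    rw [← partialF_mul_partialF hk hkn hnl]; ring
  have hint' : Integrable (fun ω => partialF α ψ k n ω ^ 2 * partialF α ψ n l ω ^ 2 -
      2 * (partialF α ψ k n ω ^ 2 * partialF α ψ n l ω ^ 1)) P :=
    (hint 2).sub ((hint 1).const_mul 2)
  simp only [e]
  rw [integral_add hint' (hint 0), integral_sub (hint 2) ((hint 1).const_mul 2), integral_const_mul,
    hψ.integral_partialF_pow_mul_pow hm h0 h1 hk hkn hnl,
    hψ.integral_partialF_pow_mul_pow hm h0 h1 hk hkn hnl,
    hψ.integral_partialF_pow_mul_pow hm h0 h1 hk hkn hnl]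
  have hf0 : ∏ j ∈ Finset.Icc (n + 1) l, factorMoment m α 0 j = 1 := by
    simp [factorMoment]
  have b2 := abs_prod_sub_one_le (q := factorMoment m α 2) (by norm_num)
    (fun j hj => abs_factorMoment_two_sub_one_le hm h0 h1 hj) hn hnl
  have b3 := abs_prod_sub_one_le (q := factorMoment m α 2) (by norm_num)
    (fun j hj => abs_factorMoment_two_sub_one_le hm h0 h1 hj) hk hkn
  have b1 := hψ.abs_integral_partialF_sub_one_le hm h0 h1 hn hnl
  rw [hψ.integral_partialF hm h0 h1 hn hnl] at b1
  rw [hf0]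
  rw [← errConst] at b2 b3
  have hE := errConst_pos
  have b4 : errConst / k ≤ errConst := div_le_self hE.le hk0
  rw [abs_le] at b1 b2 b3
  have b0 : 0 ≤ ∏ j ∈ Finset.Icc (k + 1) n, factorMoment m α 2 j := by
    refine Finset.prod_nonneg fun j hj => ?_
    have hj2 : 2 ≤ j := by have := Finset.mem_Icc.1 hj; omega
    exact mul_nonneg (sq_nonneg _)
      (div_nonneg (ascPochhammer_eval_pos (oldWeight_pos hm h0 h1 hj2) 2).le
        (ascPochhammer_eval_pos (totalWeight_pos hm h0 h1 hj2) 2).le)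
  generalize ∏ j ∈ Finset.Icc (k + 1) n, factorMoment m α 2 j = x at *
  generalize ∏ j ∈ Finset.Icc (n + 1) l, factorMoment m α 2 j = y at *
  generalize ∏ j ∈ Finset.Icc (n + 1) l, factorMoment m α 1 j = z at *
  calc x * y - 2 * (x * z) + x * 1 = x * ((y - 1) - 2 * (z - 1)) := by ring
    _ ≤ x * (3 * (errConst / n)) := mul_le_mul_of_nonneg_left (by linarith) b0
    _ ≤ (1 + errConst) * (3 * (errConst / n)) :=
        mul_le_mul_of_nonneg_right (by linarith) (by positivity)
    _ = 3 * (1 + errConst) * errConst / n := by ring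

end Strengths

/-! ### Existence and properties of the limits `F_k` -/

/-- If `g` is nonnegative and nonincreasing, convergence of `(l / k) ^ χ * g l` along the fourth
powers implies convergence: the factor `(l / k) ^ χ` varies little between consecutive fourth
powers. -/
lemma tendsto_of_tendsto_pow_four {g : ℕ → ℝ} {k : ℕ} {χ L : ℝ} (hk : 1 ≤ k) (hχ : 0 ≤ χ)
    (hg0 : ∀ n, 0 ≤ g n) (hg : ∀ i j, i ≤ j → g j ≤ g i)
    (h : Tendsto (fun i : ℕ => ((i ^ 4 : ℕ) / (k : ℝ)) ^ χ * g (i ^ 4)) atTop (𝓝 L)) :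
    Tendsto (fun l : ℕ => ((l : ℝ) / k) ^ χ * g l) atTop (𝓝 L) := by
  have hk' : (0 : ℝ) < k := by exact_mod_cast hk
  set s : ℕ → ℕ := fun l => Nat.sqrt (Nat.sqrt l) with hs
  have hle : ∀ l, s l ^ 4 ≤ l := fun l => by
    calc s l ^ 4 = (s l ^ 2) ^ 2 := by ring
      _ ≤ (Nat.sqrt l) ^ 2 := Nat.pow_le_pow_left (Nat.sqrt_le' _) 2
      _ ≤ l := Nat.sqrt_le' l
  have hlt : ∀ l, l ≤ (s l + 1) ^ 4 := fun l => by
    calc l ≤ (Nat.sqrt l + 1) ^ 2 := (Nat.lt_succ_sqrt' l).le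
      _ ≤ ((s l + 1) ^ 2) ^ 2 := Nat.pow_le_pow_left (Nat.lt_succ_sqrt' _) 2
      _ = (s l + 1) ^ 4 := by ring
  have hs_top : Tendsto s atTop atTop := by
    refine tendsto_atTop.2 fun b => ?_
    filter_upwards [eventually_ge_atTop (b ^ 4)] with l hl
    refine Nat.le_sqrt'.2 (Nat.le_sqrt'.2 ?_)
    calc (b ^ 2) ^ 2 = b ^ 4 := by ring
      _ ≤ l := hl
  have hr : Tendsto (fun i : ℕ => ((((i : ℝ) + 1) / i) ^ 4) ^ χ) atTop (𝓝 1) := by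
    have h1 : Tendsto (fun i : ℕ => ((i : ℝ) + 1) / i) atTop (𝓝 1) := by
      have := tendsto_one_div_atTop_nhds_zero_nat (𝕜 := ℝ)
      have := this.const_add 1
      rw [add_zero] at this
      refine this.congr' ?_
      filter_upwards [eventually_gt_atTop 0] with i hi
      have : (i : ℝ) ≠ 0 := by positivity
      field_simp
    have h2 := (h1.pow 4).rpow_const (p := χ) (Or.inl (by norm_num))
    simpa using h2
  have hup : Tendsto (fun l => ((((s l : ℝ) + 1) / s l) ^ 4) ^ χ *
      (((s l ^ 4 : ℕ) / (k : ℝ)) ^ χ * g (s l ^ 4))) atTop (𝓝 L) := by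
    simpa [Function.comp_def] using (hr.mul h).comp hs_top
  have hdown : Tendsto (fun l => (((((s l : ℝ) + 1) / s l) ^ 4) ^ χ)⁻¹ *
      ((((s l + 1) ^ 4 : ℕ) / (k : ℝ)) ^ χ * g ((s l + 1) ^ 4))) atTop (𝓝 L) := by
    have h3 := (hr.inv₀ one_ne_zero).mul (h.comp (tendsto_add_atTop_nat 1))
    simpa [Function.comp_def] using h3.comp hs_top
  refine tendsto_of_tendsto_of_tendsto_of_le_of_le' hdown hup ?_ ?_
  · filter_upwards [hs_top.eventually_gt_atTop 0] with l hl
    have hl' : (0 : ℝ) < s l := by exact_mod_cast hl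
    have h4 : ((s l : ℝ)) ^ 4 ≤ l := by exact_mod_cast hle l
    rw [← mul_assoc, ← Real.inv_rpow (by positivity),
      ← Real.mul_rpow (by positivity) (by positivity)]
    refine mul_le_mul (Real.rpow_le_rpow (by positivity) ?_ hχ) (hg _ _ (hlt l)) (hg0 _)
      (by positivity)
    push_cast
    rw [div_pow, inv_div, ← mul_div_assoc, div_mul_cancel₀ _ (by positivity)]
    gcongr
  · filter_upwards [hs_top.eventually_gt_atTop 0] with l hl
    have hl' : (0 : ℝ) < s l := by exact_mod_cast hl
    have h4 : (l : ℝ) ≤ ((s l : ℝ) + 1) ^ 4 := by exact_mod_cast hlt l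
    rw [← mul_assoc, ← Real.mul_rpow (by positivity) (by positivity)]
    refine mul_le_mul (Real.rpow_le_rpow (by positivity) ?_ hχ) (hg _ _ (hle l)) (hg0 _)
      (by positivity)
    push_cast
    rw [div_pow, ← mul_div_assoc, div_mul_cancel₀ _ (by positivity)]
    gcongr

section Limits

variable {Ω : Type*} [MeasurableSpace Ω] {P : Measure Ω} [IsProbabilityMeasure P]
  {ψ : ℕ → Ω → ℝ} {m : ℕ} {α : ℝ}

/-- The constant in the `L²` estimates. -/
noncomputable def sqConst : ℝ := 3 * (1 + errConst) * errConst

lemma sqConst_pos : 0 < sqConst := by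
  have := errConst_pos
  unfold sqConst
  positivity

lemma IsPolyaStrengths.eLpNorm_partialF_sub_le (hm : 1 ≤ m) (h0 : 0 ≤ α) (h1 : α < 1)
    (hψ : IsPolyaStrengths m α ψ P) {k n l : ℕ} (hk : 1 ≤ k) (hkn : k ≤ n) (hnl : n ≤ l) :
    eLpNorm (partialF α ψ k l - partialF α ψ k n) 2 P ≤
      ENNReal.ofReal (Real.sqrt (sqConst / n)) := by
  have hL : MemLp (partialF α ψ k l - partialF α ψ k n) 2 P :=
    (hψ.memLp_partialF hk l 2).sub (hψ.memLp_partialF hk n 2)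
  rw [hL.eLpNorm_eq_integral_rpow_norm (by norm_num) (by norm_num)]
  refine ENNReal.ofReal_le_ofReal ?_
  rw [Real.sqrt_eq_rpow]
  simp only [ENNReal.toReal_ofNat, Real.rpow_ofNat, one_div, Pi.sub_apply, Real.norm_eq_abs,
    sq_abs]
  exact Real.rpow_le_rpow (integral_nonneg fun ω => sq_nonneg _)
    (hψ.integral_sq_partialF_sub_le hm h0 h1 hk hkn hnl) (by norm_num)

lemma IsPolyaStrengths.ae_exists_tendsto_partialF (hm : 1 ≤ m) (h0 : 0 ≤ α) (h1 : α < 1)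
    (hψ : IsPolyaStrengths m α ψ P) {k : ℕ} (hk : 1 ≤ k) :
    ∀ᵐ ω ∂P, ∃ L, Tendsto (fun l => partialF α ψ k l ω) atTop (𝓝 L) := by
  have hk0 : (0 : ℝ) < k := by exact_mod_cast hk
  have hC := sqConst_pos
  -- Along `l = (i + k) ^ 4` the `L²` bound is of order `(i + k) ^ (-2)`, which is summable.
  have hsub : ∀ᵐ ω ∂P, ∃ L,
      Tendsto (fun i : ℕ => partialF α ψ k ((i + k) ^ 4) ω) atTop (𝓝 L) := by
    refine Lp.ae_tendsto_of_cauchy_eLpNorm (p := 2)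
      (B := fun N => ENNReal.ofReal ((Real.sqrt sqConst + 1) * (1 / ((N : ℝ) + k) ^ 2)))
      (fun i => hψ.aestronglyMeasurable_partialF k _) (by norm_num) ?_ ?_
    · refine Summable.tsum_ofReal_ne_top (Summable.mul_left _ ?_)
      have := (summable_nat_add_iff (f := fun n : ℕ => 1 / (n : ℝ) ^ 2) k).2
        (Real.summable_one_div_nat_pow.2 (by norm_num))
      simpa using this
    · have key : ∀ N n l : ℕ, N ≤ n → n ≤ l →
          eLpNorm (partialF α ψ k ((l + k) ^ 4) - partialF α ψ k ((n + k) ^ 4)) 2 P <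
            ENNReal.ofReal ((Real.sqrt sqConst + 1) * (1 / ((N : ℝ) + k) ^ 2)) := by
        intro N n l hN hnl
        refine (hψ.eLpNorm_partialF_sub_le hm h0 h1 hk ?_ ?_).trans_lt ?_
        · calc k ≤ n + k := by omega
            _ ≤ (n + k) ^ 4 := Nat.le_self_pow (by norm_num) _
        · exact Nat.pow_le_pow_left (by omega) 4
        · rw [ENNReal.ofReal_lt_ofReal_iff (by positivity)]
          have e : Real.sqrt (sqConst / ((n + k) ^ 4 : ℕ)) =
              Real.sqrt sqConst * (1 / ((n : ℝ) + k) ^ 2) := by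
            push_cast
            rw [Real.sqrt_div hC.le, show ((n : ℝ) + k) ^ 4 = (((n : ℝ) + k) ^ 2) ^ 2 by ring,
              Real.sqrt_sq (by positivity)]
            ring
          rw [e]
          have hN' : (N : ℝ) ≤ n := by exact_mod_cast hN
          calc Real.sqrt sqConst * (1 / ((n : ℝ) + k) ^ 2)
              ≤ Real.sqrt sqConst * (1 / ((N : ℝ) + k) ^ 2) := by gcongr
            _ < (Real.sqrt sqConst + 1) * (1 / ((N : ℝ) + k) ^ 2) := by
                gcongr
                linarith
      intro N n l hn hl
      rcases le_total n l with h | h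
      · rw [eLpNorm_sub_comm]
        exact key N n l hn h
      · exact key N l n hl h
  filter_upwards [hsub, hψ.ae_mem_Ioo] with ω ⟨L, hL⟩ hω
  have hI : ∀ j ≥ k + 1, 0 ≤ 1 - ψ j ω ∧ 1 - ψ j ω ≤ 1 := fun j hj => by
    have := hω j (by omega)
    exact ⟨by linarith [this.2], by linarith [this.1]⟩
  refine ⟨L, tendsto_of_tendsto_pow_four hk (by linarith [half_le_chi h0 h1])
    (g := fun l => ∏ j ∈ Finset.Icc (k + 1) l, (1 - ψ j ω)) (fun n => ?_) (fun i j hij => ?_) ?_⟩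
  · exact Finset.prod_nonneg fun j hj => (hI j (Finset.mem_Icc.1 hj).1).1
  · rw [← Finset.prod_sdiff (Finset.Icc_subset_Icc_right hij)]
    have hmem : ∀ l ∈ Finset.Icc (k + 1) j \ Finset.Icc (k + 1) i, k + 1 ≤ l := fun l hl =>
      (Finset.mem_Icc.1 (Finset.mem_sdiff.1 hl).1).1
    exact mul_le_of_le_one_left (Finset.prod_nonneg fun l hl => (hI l (Finset.mem_Icc.1 hl).1).1)
      (Finset.prod_le_one (fun l hl => (hI l (hmem l hl)).1) fun l hl => (hI l (hmem l hl)).2)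
  · exact (tendsto_add_atTop_iff_nat k).1 hL

lemma IsPolyaStrengths.ae_tendsto_limF (hm : 1 ≤ m) (h0 : 0 ≤ α) (h1 : α < 1)
    (hψ : IsPolyaStrengths m α ψ P) {k : ℕ} (hk : 1 ≤ k) :
    ∀ᵐ ω ∂P, Tendsto (fun l => partialF α ψ k l ω) atTop (𝓝 (limF α ψ k ω)) := by
  filter_upwards [hψ.ae_exists_tendsto_partialF hm h0 h1 hk] with ω h
  exact tendsto_nhds_limUnder h

lemma IsPolyaStrengths.aestronglyMeasurable_limF (hm : 1 ≤ m) (h0 : 0 ≤ α) (h1 : α < 1)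
    (hψ : IsPolyaStrengths m α ψ P) {k : ℕ} (hk : 1 ≤ k) :
    AEStronglyMeasurable (limF α ψ k) P :=
  aestronglyMeasurable_of_tendsto_ae atTop (fun l => hψ.aestronglyMeasurable_partialF k l)
    (hψ.ae_tendsto_limF hm h0 h1 hk)

/-- The `L²` distance between `F_{k, n}` and its limit, by Fatou's lemma. -/
lemma IsPolyaStrengths.eLpNorm_limF_sub_le (hm : 1 ≤ m) (h0 : 0 ≤ α) (h1 : α < 1)
    (hψ : IsPolyaStrengths m α ψ P) {k n : ℕ} (hk : 1 ≤ k) (hkn : k ≤ n) :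
    eLpNorm (limF α ψ k - partialF α ψ k n) 2 P ≤ ENNReal.ofReal (Real.sqrt (sqConst / n)) := by
  refine (Lp.eLpNorm_lim_le_liminf_eLpNorm (f := fun l => partialF α ψ k l - partialF α ψ k n)
    (fun l => (hψ.aestronglyMeasurable_partialF k l).sub (hψ.aestronglyMeasurable_partialF k n))
    _ ?_).trans ?_
  · filter_upwards [hψ.ae_tendsto_limF hm h0 h1 hk] with ω h
    exact h.sub_const _
  · refine liminf_le_of_frequently_le' (Eventually.frequently ?_)
    filter_upwards [eventually_ge_atTop n] with l hl
    exact hψ.eLpNorm_partialF_sub_le hm h0 h1 hk hkn hl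

lemma IsPolyaStrengths.memLp_limF (hm : 1 ≤ m) (h0 : 0 ≤ α) (h1 : α < 1)
    (hψ : IsPolyaStrengths m α ψ P) {k : ℕ} (hk : 1 ≤ k) : MemLp (limF α ψ k) 2 P := by
  have h : MemLp (limF α ψ k - partialF α ψ k k) 2 P :=
    ⟨(hψ.aestronglyMeasurable_limF hm h0 h1 hk).sub (hψ.aestronglyMeasurable_partialF k k),
      (hψ.eLpNorm_limF_sub_le hm h0 h1 hk le_rfl).trans_lt ENNReal.ofReal_lt_top⟩
  simpa using h.add (hψ.memLp_partialF hk k 2)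

lemma tendsto_ofReal_sqrt_div (C : ℝ) :
    Tendsto (fun n : ℕ => ENNReal.ofReal (Real.sqrt (C / n))) atTop (𝓝 0) := by
  have h := (tendsto_const_div_atTop_nhds_zero_nat C).sqrt
  rw [Real.sqrt_zero] at h
  simpa using ENNReal.tendsto_ofReal h

lemma IsPolyaStrengths.tendsto_eLpNorm_partialF_sub_limF (hm : 1 ≤ m) (h0 : 0 ≤ α) (h1 : α < 1)
    (hψ : IsPolyaStrengths m α ψ P) {k : ℕ} (hk : 1 ≤ k) :
    Tendsto (fun n => eLpNorm (partialF α ψ k n - limF α ψ k) 2 P) atTop (𝓝 0) := by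
  refine tendsto_of_tendsto_of_tendsto_of_le_of_le' tendsto_const_nhds
    (tendsto_ofReal_sqrt_div sqConst) (Eventually.of_forall fun n => zero_le) ?_
  filter_upwards [eventually_ge_atTop k] with n hn
  rw [eLpNorm_sub_comm]
  exact hψ.eLpNorm_limF_sub_le hm h0 h1 hk hn

/-- `E (F_k - 1) ^ 2 = O(1 / k)`, combined with Chebyshev's inequality. -/
lemma IsPolyaStrengths.measure_abs_limF_sub_one_ge_le (hm : 1 ≤ m) (h0 : 0 ≤ α) (h1 : α < 1)
    (hψ : IsPolyaStrengths m α ψ P) {k : ℕ} (hk : 1 ≤ k) {ε : ℝ} (hε : 0 < ε) :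
    P {ω | ε ≤ |limF α ψ k ω - 1|} ≤ ENNReal.ofReal (sqConst / (ε ^ 2 * k)) := by
  have hk0 : (0 : ℝ) < k := by exact_mod_cast hk
  have h := hψ.eLpNorm_limF_sub_le hm h0 h1 hk le_rfl
  have e : partialF α ψ k k = fun _ => 1 := funext fun ω => partialF_self hk ω
  have h2 := meas_ge_le_mul_pow_eLpNorm_enorm P (p := 2) (by norm_num) (by norm_num)
    ((hψ.aestronglyMeasurable_limF hm h0 h1 hk).sub (hψ.aestronglyMeasurable_partialF k k))
    (ε := ENNReal.ofReal ε) (by simpa using hε) (by simp)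
  have e2 : {ω | ε ≤ |limF α ψ k ω - 1|} =
      {ω | ENNReal.ofReal ε ≤ ‖(limF α ψ k - partialF α ψ k k) ω‖ₑ} := by
    ext ω
    simp only [Set.mem_ofPred_eq, Pi.sub_apply, e, ← ofReal_norm, Real.norm_eq_abs]
    rw [ENNReal.ofReal_le_ofReal_iff (abs_nonneg _)]
  rw [e2]
  refine h2.trans ?_
  simp only [ENNReal.toReal_ofNat, ENNReal.rpow_ofNat]
  calc (ENNReal.ofReal ε)⁻¹ ^ 2 * eLpNorm (limF α ψ k - partialF α ψ k k) 2 P ^ 2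
      ≤ (ENNReal.ofReal ε)⁻¹ ^ 2 * ENNReal.ofReal (Real.sqrt (sqConst / k)) ^ 2 := by gcongr
    _ = ENNReal.ofReal (sqConst / (ε ^ 2 * k)) := by
        rw [← ENNReal.ofReal_inv_of_pos hε, ← ENNReal.ofReal_pow (by positivity),
          ← ENNReal.ofReal_pow (by positivity), ← ENNReal.ofReal_mul (by positivity),
          Real.sq_sqrt (div_nonneg sqConst_pos.le hk0.le)]
        congr 1
        field_simp

/-- `F_k` is a positive multiple of `F_l` for every `l ≥ k`, and `F_l` is close to `1`. -/
lemma IsPolyaStrengths.ae_limF_pos (hm : 1 ≤ m) (h0 : 0 ≤ α) (h1 : α < 1)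
    (hψ : IsPolyaStrengths m α ψ P) {k : ℕ} (hk : 1 ≤ k) : ∀ᵐ ω ∂P, 0 < limF α ψ k ω := by
  have hk0 : (0 : ℝ) < k := by exact_mod_cast hk
  have hbound : ∀ l, k ≤ l → P {ω | ¬ 0 < limF α ψ k ω} ≤
      ENNReal.ofReal (4 * sqConst / l) := by
    intro l hkl
    have hl : 1 ≤ l := hk.trans hkl
    have hl0 : (0 : ℝ) < l := by exact_mod_cast hl
    have h := hψ.measure_abs_limF_sub_one_ge_le hm h0 h1 hl (ε := 1 / 2) (by norm_num)
    refine (measure_mono_ae ?_).trans (h.trans (le_of_eq ?_))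
    · filter_upwards [hψ.ae_tendsto_limF hm h0 h1 hk, hψ.ae_tendsto_limF hm h0 h1 hl,
        hψ.ae_mem_Ioo] with ω hω1 hω2 hω3 hneg
      have hpos : 0 < partialF α ψ k l ω := by
        refine mul_pos (by positivity) (Finset.prod_pos fun j hj => ?_)
        have := hω3 j (by have := Finset.mem_Icc.1 hj; omega)
        linarith [this.2]
      have hlim : limF α ψ k ω = partialF α ψ k l ω * limF α ψ l ω := by
        refine tendsto_nhds_unique hω1 ((hω2.const_mul _).congr' ?_)
        filter_upwards [eventually_ge_atTop l] with n hn
        exact partialF_mul_partialF hk hkl hn ω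
      have hneg' : ¬ 0 < limF α ψ k ω := hneg
      have : limF α ψ l ω ≤ 0 := by
        by_contra hc
        exact hneg' (hlim ▸ mul_pos hpos (not_le.1 hc))
      change (1 / 2 : ℝ) ≤ |limF α ψ l ω - 1|
      rw [abs_of_nonpos (by linarith)]
      linarith
    · congr 1
      field_simp
      norm_num
  have hlim : Tendsto (fun l : ℕ => ENNReal.ofReal (4 * sqConst / l)) atTop (𝓝 0) := by
    simpa using ENNReal.tendsto_ofReal (tendsto_const_div_atTop_nhds_zero_nat (4 * sqConst))
  refine ae_iff.2 (le_antisymm (ge_of_tendsto hlim ?_) (zero_le))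
  filter_upwards [eventually_ge_atTop k] with l hl using hbound l hl

lemma abs_log_le_two_mul {x : ℝ} (h : |x - 1| ≤ 1 / 2) : |Real.log x| ≤ 2 * |x - 1| := by
  obtain ⟨h1, h2⟩ := abs_le.1 h
  have hx : 0 < x := by linarith
  have hup := Real.log_le_sub_one_of_pos hx
  have hlow := Real.one_sub_inv_le_log_of_pos hx
  have hinv : 1 - x⁻¹ = (x - 1) / x := by field_simp
  have h3 : -(2 * |x - 1|) ≤ (x - 1) / x := by
    rw [le_div_iff₀ hx]
    have := neg_abs_le (x - 1)
    have := abs_nonneg (x - 1)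
    nlinarith
  exact abs_le.2 ⟨by linarith, by linarith [le_abs_self (x - 1), abs_nonneg (x - 1)]⟩

/-- For large `k` the bound comes from the `L²` estimate; the finitely many remaining variables
are tight because each of them is finite. -/
lemma IsPolyaStrengths.isBigOPInvSqrt_log_limF (hm : 1 ≤ m) (h0 : 0 ≤ α) (h1 : α < 1)
    (hψ : IsPolyaStrengths m α ψ P) :
    IsBigOPInvSqrt P fun k ω => Real.log (limF α ψ k ω) := by
  intro ε hε
  have hC := sqConst_pos
  -- With this `x`, Chebyshev's inequality bounds `P (|F_k - 1| ≥ x / √k)` by `ε`.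
  set x : ℝ := Real.sqrt (sqConst / ε) with hx
  have hx0 : 0 < x := Real.sqrt_pos.2 (by positivity)
  have hx2 : sqConst / x ^ 2 = ε := by
    rw [hx, Real.sq_sqrt (by positivity)]
    field_simp
  have hlarge : ∀ k : ℕ, 1 ≤ k → 2 * x ≤ Real.sqrt k → ∀ C, 2 * x ≤ C →
      P {ω | C < |Real.log (limF α ψ k ω)| * Real.sqrt k} ≤ ENNReal.ofReal ε := by
    intro k hk hxk C hC
    have hk0 : (0 : ℝ) < k := by exact_mod_cast hk
    have hs : 0 < Real.sqrt k := Real.sqrt_pos.2 hk0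
    have h := hψ.measure_abs_limF_sub_one_ge_le hm h0 h1 hk (ε := x / Real.sqrt k)
      (by positivity)
    rw [div_pow, Real.sq_sqrt hk0.le, div_mul_cancel₀ _ hk0.ne', hx2] at h
    refine (measure_mono fun ω hω => ?_).trans h
    change x / Real.sqrt k ≤ |limF α ψ k ω - 1|
    have hω' : C < |Real.log (limF α ψ k ω)| * Real.sqrt k := hω
    by_contra! hc
    have h3 : x / Real.sqrt k ≤ 1 / 2 := by rw [div_le_iff₀ hs]; linarith
    have h4 := abs_log_le_two_mul (hc.le.trans h3)
    rw [lt_div_iff₀ hs] at hc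
    nlinarith
  have hsmall : ∀ k : ℕ, 1 ≤ k → ∀ᶠ C : ℝ in atTop,
      P {ω | C < |Real.log (limF α ψ k ω)| * Real.sqrt k} ≤ ENNReal.ofReal ε := by
    intro k hk
    have hmeas : AEMeasurable (fun ω => |Real.log (limF α ψ k ω)| * Real.sqrt k) P := by
      have := (hψ.aestronglyMeasurable_limF hm h0 h1 hk).aemeasurable
      exact (Real.measurable_log.comp_aemeasurable this).abs.mul_const _
    have h := tendsto_measure_norm_gt_of_isTightMeasureSet (isTightMeasureSet_singleton
      (μ := P.map fun ω => |Real.log (limF α ψ k ω)| * Real.sqrt k))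
    filter_upwards [h.eventually_lt_const (ENNReal.ofReal_pos.2 hε)] with C hC
    rw [iSup_singleton, Measure.map_apply_of_aemeasurable hmeas
      (measurableSet_lt measurable_const measurable_norm)] at hC
    refine (measure_mono fun ω hω => ?_).trans hC.le
    exact lt_of_lt_of_le (Set.mem_ofPred_eq ▸ hω) (le_abs_self _)
  -- Beyond `k = (2 * x) ^ 2` the estimate `hlarge` applies.
  have hall : ∀ᶠ C : ℝ in atTop, ∀ k : ℕ, 1 ≤ k →
      P {ω | C < |Real.log (limF α ψ k ω)| * Real.sqrt k} ≤ ENNReal.ofReal ε := by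
    obtain ⟨K, hK⟩ := exists_nat_ge ((2 * x) ^ 2)
    have hfin : ∀ᶠ C : ℝ in atTop, ∀ k ∈ Finset.Icc 1 K,
        P {ω | C < |Real.log (limF α ψ k ω)| * Real.sqrt k} ≤ ENNReal.ofReal ε :=
      (Finset.eventually_all _).2 fun k hk => hsmall k (Finset.mem_Icc.1 hk).1
    filter_upwards [hfin, eventually_ge_atTop (2 * x)] with C h1 h2 k hk
    by_cases hkK : k ≤ K
    · exact h1 k (Finset.mem_Icc.2 ⟨hk, hkK⟩)
    · refine hlarge k hk (Real.le_sqrt_of_sq_le (hK.trans ?_)) C h2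
      exact_mod_cast (not_le.1 hkK).le
  exact hall.exists

lemma IsPolyaStrengths.tendsto_integral_partialF (hm : 1 ≤ m) (h0 : 0 ≤ α) (h1 : α < 1)
    (hψ : IsPolyaStrengths m α ψ P) {k : ℕ} (hk : 1 ≤ k) :
    Tendsto (fun l => ∫ ω, partialF α ψ k l ω ∂P) atTop (𝓝 (∫ ω, limF α ψ k ω ∂P)) := by
  refine tendsto_integral_of_L1' _ (hψ.aestronglyMeasurable_limF hm h0 h1 hk)
    (Eventually.of_forall fun l => (hψ.memLp_partialF hk l 1).integrable le_rfl) ?_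
  refine tendsto_of_tendsto_of_tendsto_of_le_of_le tendsto_const_nhds
    (hψ.tendsto_eLpNorm_partialF_sub_limF hm h0 h1 hk) (fun _ => zero_le) fun l => ?_
  exact eLpNorm_le_eLpNorm_of_exponent_le (by norm_num)
    ((hψ.aestronglyMeasurable_partialF k l).sub (hψ.aestronglyMeasurable_limF hm h0 h1 hk))

lemma IsPolyaStrengths.abs_integral_limF_sub_one_le (hm : 1 ≤ m) (h0 : 0 ≤ α) (h1 : α < 1)
    (hψ : IsPolyaStrengths m α ψ P) {k : ℕ} (hk : 1 ≤ k) :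
    |∫ ω, limF α ψ k ω ∂P - 1| ≤ errConst / k := by
  refine le_of_tendsto ((hψ.tendsto_integral_partialF hm h0 h1 hk).sub_const 1).abs ?_
  filter_upwards [eventually_ge_atTop k] with l hl
  exact hψ.abs_integral_partialF_sub_one_le hm h0 h1 hk hl

end Limits

/-! ### Laplace transforms and convergence in distribution -/

open scoped NNReal BoundedContinuousFunction

/-- The function `x ↦ e ^ (-x)` on the half line. -/
noncomputable def expNeg : ℝ≥0 →ᵇ ℝ :=
  BoundedContinuousFunction.ofNormedAddCommGroup (fun x => Real.exp (-(x : ℝ))) (by fun_prop) 1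
    fun x => by
      rw [Real.norm_eq_abs, Real.abs_exp, Real.exp_le_one_iff]
      exact neg_nonpos.2 x.2

lemma expNeg_apply (x : ℝ≥0) : expNeg x = Real.exp (-(x : ℝ)) := rfl

/-- The algebra of polynomials in `e ^ (-x)`. -/
noncomputable def expPoly : StarSubalgebra ℝ (ℝ≥0 →ᵇ ℝ) :=
  { (Polynomial.aeval (R := ℝ) expNeg).range with
    star_mem' := fun {f} hf => by
      have : star f = f := by ext x; simp
      rwa [this] }

lemma mem_expPoly {g : ℝ≥0 →ᵇ ℝ} (hg : g ∈ expPoly) :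
    ∃ p : Polynomial ℝ, ∀ x, g x = ∑ i ∈ p.support, p.coeff i * Real.exp (-(i * (x : ℝ))) := by
  obtain ⟨p, rfl⟩ : ∃ p : Polynomial ℝ, Polynomial.aeval (R := ℝ) expNeg p = g := hg
  refine ⟨p, fun x => ?_⟩
  rw [Polynomial.aeval_def, Polynomial.eval₂_eq_sum, Polynomial.sum,
    BoundedContinuousFunction.coe_sum, Finset.sum_apply]
  refine Finset.sum_congr rfl fun i _ => ?_
  simp [expNeg_apply, ← Real.exp_nat_mul]

/-- Convergence of the Laplace transforms at the nonnegative integers, together with bounded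
means, implies convergence in distribution: the polynomials in `e ^ (-x)` separate the points of
the half line. -/
lemma tendstoInDistribution_of_tendsto_laplace {Ω' : ℕ → Type*} {mΩ' : ∀ n, MeasurableSpace (Ω' n)}
    {μ : (n : ℕ) → Measure (Ω' n)} [∀ n, IsProbabilityMeasure (μ n)]
    {Ω : Type*} {mΩ : MeasurableSpace Ω} {P : Measure Ω} [IsProbabilityMeasure P]
    {X : (n : ℕ) → Ω' n → ℝ≥0} {Z : Ω → ℝ≥0} (hX : ∀ n, AEMeasurable (X n) (μ n))
    (hZ : AEMeasurable Z P) {C : ℝ≥0} (hC : ∀ n, ∫⁻ ω, X n ω ∂μ n ≤ C)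
    (h : ∀ i : ℕ, Tendsto (fun n => ∫ ω, Real.exp (-(i * (X n ω : ℝ))) ∂μ n) atTop
      (𝓝 (∫ ω, Real.exp (-(i * (Z ω : ℝ))) ∂P))) :
    TendstoInDistribution X atTop Z μ P where
  forall_aemeasurable := hX
  aemeasurable_limit := hZ
  tendsto := by
    refine ProbabilityMeasure.tendsto_of_tight_of_separatesPoints ℝ ?_ (A := expPoly) ?_ ?_
    · rw [isTightMeasureSet_iff_exists_isCompact_measure_compl_le]
      intro ε hε
      obtain rfl | hε' := eq_or_ne ε ⊤
      · exact ⟨∅, isCompact_empty, fun _ _ => le_top⟩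
      set r : ℝ≥0 := ((C : ENNReal) / ε).toNNReal + 1 with hr
      have hr0 : (r : ENNReal) ≠ 0 := by simp [hr]
      have hCr : (C : ENNReal) ≤ ε * r := by
        have h1 : (C : ENNReal) / ε ≤ r := by
          rw [hr, ENNReal.coe_add, ENNReal.coe_toNNReal (ENNReal.div_ne_top (by simp) hε.ne')]
          exact le_self_add
        rw [mul_comm]
        exact (ENNReal.div_le_iff hε.ne' hε').1 h1
      refine ⟨Set.Icc 0 r, isCompact_Icc, ?_⟩
      rintro _ ⟨n, rfl⟩
      rw [ProbabilityMeasure.coe_mk, Measure.map_apply_of_aemeasurable (hX n)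
        measurableSet_Icc.compl]
      have h2 := meas_ge_le_lintegral_div (μ := μ n) (f := fun ω => (X n ω : ENNReal))
        (hX n).coe_nnreal_ennreal hr0 (by simp)
      refine (measure_mono fun ω hω => ?_).trans (h2.trans ?_)
      · have hω' : ¬ (0 ≤ X n ω ∧ X n ω ≤ r) := hω
        exact ENNReal.coe_le_coe.2 (not_le.1 fun hc => hω' ⟨zero_le, hc⟩).le
      · exact ENNReal.div_le_of_le_mul ((hC n).trans hCr)
    · intro x y hxy
      refine ⟨_, ⟨_, ⟨expNeg, ⟨Polynomial.X, Polynomial.aeval_X _⟩, rfl⟩, rfl⟩, ?_⟩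
      simpa [expNeg_apply] using hxy
    · intro g hg
      obtain ⟨p, hp⟩ := mem_expPoly hg
      have key : ∀ (ν : Measure ℝ≥0) [IsProbabilityMeasure ν], ∫ x, g x ∂ν =
          ∑ i ∈ p.support, p.coeff i * ∫ x : ℝ≥0, Real.exp (-(i * (x : ℝ))) ∂ν := by
        intro ν _
        simp only [hp]
        rw [integral_finsetSum]
        · simp only [integral_const_mul]
        · intro i _
          refine Integrable.const_mul ?_ _
          refine Integrable.of_bound (C := 1) (by fun_prop) (Eventually.of_forall fun x => ?_)
          rw [Real.norm_eq_abs, Real.abs_exp, Real.exp_le_one_iff]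
          have := x.2
          exact neg_nonpos.2 (by positivity)
      have hmap : ∀ (i : ℕ) (n : ℕ), ∫ x : ℝ≥0, Real.exp (-(i * (x : ℝ))) ∂((μ n).map (X n)) =
          ∫ ω, Real.exp (-(i * (X n ω : ℝ))) ∂μ n := fun i n =>
        integral_map (hX n) (by fun_prop)
      simp only [ProbabilityMeasure.coe_mk]
      have := Measure.isProbabilityMeasure_map hZ
      have := fun n => Measure.isProbabilityMeasure_map (hX n)
      rw [key (P.map Z)]
      simp only [key ((μ _).map (X _)), hmap]
      refine tendsto_finsetSum _ fun i _ => ?_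
      rw [integral_map hZ (by fun_prop)]
      exact (h i).const_mul _

/-! ### The Laplace transform of the degrees -/

lemma ae_mem_support {β : Type*} [MeasurableSpace β] [MeasurableSingletonClass β] [Countable β]
    (p : PMF β) : ∀ᵐ a ∂p.toMeasure, a ∈ p.support := by
  refine ae_iff.2 ((PMF.toMeasure_apply_eq_zero_iff p (Set.to_countable _).measurableSet).2 ?_)
  exact Set.disjoint_left.2 fun a ha hc => hc ha

lemma exists_deg_le (m : ℕ) (α : ℝ) (n k : ℕ) :
    ∃ D : ℕ, ∀ G ∈ (graphLaw m α n).support, deg G k ≤ D := by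
  match n with
  | 0 => exact ⟨0, fun G hG => by simp_all [graphLaw, deg]⟩
  | 1 => exact ⟨0, fun G hG => by simp_all [graphLaw, deg]⟩
  | n + 2 => exact ⟨m * (n + 1), fun G hG =>
      (Multiset.countP_le_card _ _).trans (graphLaw_support n hG).2.le⟩

lemma integrable_deg (m : ℕ) (α : ℝ) (n k : ℕ) :
    Integrable (fun G => (deg G k : ℝ)) (graphLaw m α n).toMeasure := by
  obtain ⟨D, hD⟩ := exists_deg_le m α n k
  refine Integrable.of_bound (measurable_of_countable _).aestronglyMeasurable (D : ℝ) ?_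
  filter_upwards [ae_mem_support (graphLaw m α n)] with G hG
  simpa using hD G hG

lemma integrable_ascPochhammer_deg {m : ℕ} {α : ℝ} (h0 : 0 ≤ α) (h1 : α < 1) (n k p : ℕ) :
    Integrable (fun G => (ascPochhammer ℝ p).eval (deg G k + 2 * m * uParam α))
      (graphLaw m α n).toMeasure := by
  have hu := uParam_nonneg h0 h1
  obtain ⟨D, hD⟩ := exists_deg_le m α n k
  refine Integrable.of_bound (measurable_of_countable _).aestronglyMeasurable
    ((ascPochhammer ℝ p).eval (D + 2 * m * uParam α)) ?_
  filter_upwards [ae_mem_support (graphLaw m α n)] with G hG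
  have hG' : (deg G k : ℝ) ≤ D := by exact_mod_cast hD G hG
  have h := ascPochhammer_eval_mono (x := deg G k + 2 * m * uParam α)
    (y := D + 2 * m * uParam α) (by positivity) (by linarith) p
  rw [Real.norm_eq_abs, abs_of_nonneg h.1]
  exact h.2

/-- `(1 + x_n) ^ (-w_n) → e ^ (-L)` when `x_n → 0` and `w_n x_n → L`. -/
lemma tendsto_one_add_rpow_neg {x w : ℕ → ℝ} {L : ℝ} (hx0 : ∀ᶠ n in atTop, 0 ≤ x n)
    (hw0 : ∀ᶠ n in atTop, 0 ≤ w n) (hx : Tendsto x atTop (𝓝 0))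
    (hwx : Tendsto (fun n => w n * x n) atTop (𝓝 L)) :
    Tendsto (fun n => (1 + x n) ^ (-w n)) atTop (𝓝 (Real.exp (-L))) := by
  have hlog : Tendsto (fun n => w n * Real.log (1 + x n)) atTop (𝓝 L) := by
    have hlow : Tendsto (fun n => w n * x n * (1 + x n)⁻¹) atTop (𝓝 L) := by
      have := hwx.mul ((hx.const_add 1).inv₀ (by norm_num))
      simpa using this
    refine tendsto_of_tendsto_of_tendsto_of_le_of_le' hlow hwx ?_ ?_
    · filter_upwards [hx0, hw0] with n h2 h3
      rw [mul_assoc]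
      refine mul_le_mul_of_nonneg_left ?_ h3
      refine le_trans (le_of_eq ?_) (Real.one_sub_inv_le_log_of_pos (by linarith))
      have : 1 + x n ≠ 0 := by linarith
      field_simp
      ring
    · filter_upwards [hx0, hw0] with n h2 h3
      refine mul_le_mul_of_nonneg_left ?_ h3
      linarith [Real.log_le_sub_one_of_pos (show 0 < 1 + x n by linarith)]
  refine ((Real.continuous_exp.tendsto _).comp hlog.neg).congr' ?_
  filter_upwards [hx0] with n h2
  rw [Real.rpow_def_of_pos (by linarith), Function.comp_apply]
  congr 1
  ring

lemma tendsto_exp_div_sub_one_mul {N : ℕ → ℝ} (hN : Tendsto N atTop atTop) (t : ℝ) :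
    Tendsto (fun n => (Real.exp (t / N n) - 1) * N n) atTop (𝓝 t) := by
  have h0 : Tendsto (fun n => t / N n) atTop (𝓝 0) := tendsto_const_nhds.div_atTop hN
  have hup : Tendsto (fun n => t * Real.exp (t / N n)) atTop (𝓝 t) := by
    have := ((Real.continuous_exp.tendsto 0).comp h0).const_mul t
    simpa using this
  refine tendsto_of_tendsto_of_tendsto_of_le_of_le' tendsto_const_nhds hup ?_ ?_
  · filter_upwards [hN.eventually_gt_atTop 0] with n hn
    have h2 := Real.add_one_le_exp (t / N n)
    calc t = t / N n * N n := by field_simp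
      _ ≤ _ := mul_le_mul_of_nonneg_right (by linarith) hn.le
  · filter_upwards [hN.eventually_gt_atTop 0] with n hn
    have h2 := Real.add_one_le_exp (-(t / N n))
    rw [Real.exp_neg] at h2
    have h3 := Real.exp_pos (t / N n)
    have h4 := mul_le_mul_of_nonneg_right h2 h3.le
    rw [inv_mul_cancel₀ h3.ne'] at h4
    calc (Real.exp (t / N n) - 1) * N n ≤ (t / N n * Real.exp (t / N n)) * N n :=
          mul_le_mul_of_nonneg_right (by linarith) hn.le
      _ = t * Real.exp (t / N n) := by field_simp

lemma tendsto_rpow_one_sub_chi {α : ℝ} (h1 : α < 1) :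
    Tendsto (fun n : ℕ => (n : ℝ) ^ (1 - chi α)) atTop atTop :=
  (tendsto_rpow_atTop (by linarith [chi_lt_one h1])).comp tendsto_natCast_atTop_atTop

lemma tendsto_one_sub_div (c : ℝ) : Tendsto (fun n : ℕ => 1 - c / n) atTop (𝓝 1) := by
  simpa using (tendsto_const_div_atTop_nhds_zero_nat c).const_sub 1

lemma totalWeight_mul_strength_div {Ω : Type*} {ψ : ℕ → Ω → ℝ} (m : ℕ) {α : ℝ} {k n : ℕ}
    (h1 : α < 1) (hk : 1 ≤ k) (hn : 1 ≤ n) (ω : Ω) :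
    totalWeight m α n * strength ψ k n ω / (n : ℝ) ^ (1 - chi α) =
      m / (1 - chi α) * (1 - 2 * (1 - chi α) / n) * (k : ℝ) ^ chi α *
        (ψ k ω * partialF α ψ k n ω) := by
  have hk0 : (0 : ℝ) < k := by exact_mod_cast hk
  have hn0 : (0 : ℝ) < n := by exact_mod_cast hn
  have hχ := chi_lt_one h1
  rw [totalWeight_eq m h1, strength, partialF, Real.div_rpow hn0.le hk0.le, Real.rpow_sub hn0,
    Real.rpow_one]
  have : (0 : ℝ) < (k : ℝ) ^ chi α := by positivity
  have : (0 : ℝ) < (n : ℝ) ^ chi α := by positivity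
  have : 1 - chi α ≠ 0 := by linarith
  field_simp

section Degrees

variable {Ω : Type*} [MeasurableSpace Ω] {P : Measure Ω} [IsProbabilityMeasure P]
  {ψ : ℕ → Ω → ℝ} {m : ℕ} {α : ℝ}

lemma IsPolyaStrengths.integrable_strength_pow (hψ : IsPolyaStrengths m α ψ P) {k : ℕ}
    (hk : 1 ≤ k) (n p : ℕ) : Integrable (fun ω => strength ψ k n ω ^ p) P := by
  refine Integrable.of_bound ((hψ.aemeasurable_strength hk n).pow_const p).aestronglyMeasurable
    1 ?_
  filter_upwards [hψ.ae_strength_mem hk] with ω h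
  rw [Real.norm_eq_abs, abs_of_nonneg (pow_nonneg (h n).1 p)]
  exact pow_le_one₀ (h n).1 (h n).2

/-- The rising factorial moments of the weight `deg + 2mu` of the vertex `k` in `G_n`. -/
lemma IsPolyaStrengths.integral_ascPochhammer_deg (hm : 1 ≤ m) (h0 : 0 ≤ α) (h1 : α < 1)
    (hψ : IsPolyaStrengths m α ψ P) {k n : ℕ} (hk : 1 ≤ k) (hn : max k 2 ≤ n) (p : ℕ) :
    ∫ G, (ascPochhammer ℝ p).eval (deg G k + 2 * m * uParam α) ∂(graphLaw m α n).toMeasure =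
      (ascPochhammer ℝ p).eval (totalWeight m α n) * ∫ ω, strength ψ k n ω ^ p ∂P := by
  have hu := uParam_nonneg h0 h1
  rw [integral_toMeasure_eq_toReal_expect _ fun G =>
    (ascPochhammer_eval_mono (by positivity) le_rfl p).1, expect_graphLaw hm h0 h1 hk p hn,
    ← hψ.integral_strength hm h0 h1 hk p n, ENNReal.toReal_ofReal]
  refine mul_nonneg (ascPochhammer_eval_pos
    (totalWeight_pos hm h0 h1 (le_of_max_le_right hn)) p).le (integral_nonneg_of_ae ?_)
  filter_upwards [hψ.ae_strength_mem hk] with ω h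
  exact pow_nonneg (h n).1 p

/-- Summing the rising factorial moments against the binomial series gives the Laplace transform
of the weight in terms of the strengths. -/
lemma IsPolyaStrengths.integral_one_add_rpow_deg (hm : 1 ≤ m) (h0 : 0 ≤ α) (h1 : α < 1)
    (hψ : IsPolyaStrengths m α ψ P) {k n : ℕ} (hk : 1 ≤ k) (hn : max k 2 ≤ n) {z : ℝ}
    (hz0 : 0 ≤ z) (hz1 : z < 1) :
    ∫ G, (1 + z) ^ (-(deg G k + 2 * m * uParam α)) ∂(graphLaw m α n).toMeasure =
      ∫ ω, (1 + z * strength ψ k n ω) ^ (-totalWeight m α n) ∂P := by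
  have hu := uParam_nonneg h0 h1
  have hW := totalWeight_pos hm h0 h1 (le_of_max_le_right hn)
  have hWp : ∀ p, 0 < (ascPochhammer ℝ p).eval (totalWeight m α n) := ascPochhammer_eval_pos hW
  have hz : |z| < 1 := by rwa [abs_of_nonneg hz0]
  have hS := hψ.ae_strength_mem hk
  have hM : ∀ p, 0 ≤ ∫ ω, strength ψ k n ω ^ p ∂P ∧ ∫ ω, strength ψ k n ω ^ p ∂P ≤ 1 := by
    intro p
    refine ⟨integral_nonneg_of_ae (hS.mono fun ω h => pow_nonneg (h n).1 p), ?_⟩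
    calc ∫ ω, strength ψ k n ω ^ p ∂P ≤ ∫ _, (1 : ℝ) ∂P :=
          integral_mono_ae (hψ.integrable_strength_pow hk n p) (integrable_const _)
            (hS.mono fun ω h => pow_le_one₀ (h n).1 (h n).2)
      _ = 1 := by simp
  have hdom : Summable fun p : ℕ =>
      z ^ p / (p.factorial : ℝ) * (ascPochhammer ℝ p).eval (totalWeight m α n) := by
    have := (hasSum_one_add_rpow_neg (totalWeight m α n) (z := -z) (by rwa [abs_neg])).summable
    simpa using this
  have hsum : Summable fun p : ℕ => z ^ p / (p.factorial : ℝ) *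
      ((ascPochhammer ℝ p).eval (totalWeight m α n) * ∫ ω, strength ψ k n ω ^ p ∂P) := by
    refine Summable.of_nonneg_of_le (fun p => ?_) (fun p => ?_) hdom
    · have := (hWp p).le
      have := (hM p).1
      positivity
    · have := (hWp p).le
      exact mul_le_mul_of_nonneg_left (mul_le_of_le_one_right this (hM p).2) (by positivity)
  have hnorm : ∀ p : ℕ, |(-z) ^ p / (p.factorial : ℝ)| = z ^ p / (p.factorial : ℝ) := by
    intro p
    rw [abs_div, abs_pow, abs_neg, abs_of_nonneg hz0, Nat.abs_cast]
  have hL := hasSum_integral_of_summable_integral_norm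
    (μ := (graphLaw m α n).toMeasure) (F := fun (p : ℕ) (G : Multigraph) =>
      (-z) ^ p / (p.factorial : ℝ) * (ascPochhammer ℝ p).eval (deg G k + 2 * m * uParam α))
    (fun p => (integrable_ascPochhammer_deg h0 h1 n k p).const_mul _) (by
      refine hsum.congr fun p => ?_
      rw [← hψ.integral_ascPochhammer_deg hm h0 h1 hk hn p, ← integral_const_mul]
      refine integral_congr_ae (Eventually.of_forall fun G => ?_)
      simp only [norm_mul, Real.norm_eq_abs, hnorm]
      rw [abs_of_nonneg (ascPochhammer_eval_mono (by positivity) le_rfl p).1])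
  have hR := hasSum_integral_of_summable_integral_norm
    (μ := P) (F := fun (p : ℕ) (ω : Ω) =>
      (-z) ^ p / (p.factorial : ℝ) * ((ascPochhammer ℝ p).eval (totalWeight m α n) *
        strength ψ k n ω ^ p))
    (fun p => ((hψ.integrable_strength_pow hk n p).const_mul _).const_mul _) (by
      refine hsum.congr fun p => ?_
      rw [← integral_const_mul, ← integral_const_mul]
      refine integral_congr_ae (hS.mono fun ω h => ?_)
      simp only [norm_mul, Real.norm_eq_abs, hnorm]
      rw [abs_of_pos (hWp p), abs_of_nonneg (pow_nonneg (h n).1 p)])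
  have hterm : ∀ p : ℕ, ∫ G, (-z) ^ p / (p.factorial : ℝ) *
        (ascPochhammer ℝ p).eval (deg G k + 2 * m * uParam α) ∂(graphLaw m α n).toMeasure =
      ∫ ω, (-z) ^ p / (p.factorial : ℝ) * ((ascPochhammer ℝ p).eval (totalWeight m α n) *
        strength ψ k n ω ^ p) ∂P := by
    intro p
    rw [integral_const_mul, integral_const_mul, integral_const_mul,
      hψ.integral_ascPochhammer_deg hm h0 h1 hk hn p]
  simp only [hterm] at hL
  have hLR := hL.unique hR
  simp only [(hasSum_one_add_rpow_neg _ hz).tsum_eq] at hLR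
  rw [hLR]
  refine integral_congr_ae (hS.mono fun ω h => ?_)
  have hzS : |z * strength ψ k n ω| < 1 := by
    rw [abs_of_nonneg (mul_nonneg hz0 (h n).1)]
    exact (mul_le_of_le_one_right hz0 (h n).2).trans_lt hz1
  simp only
  rw [← (hasSum_one_add_rpow_neg (totalWeight m α n) hzS).tsum_eq]
  refine tsum_congr fun p => ?_
  rw [← neg_mul, mul_pow]
  ring

lemma IsPolyaStrengths.ae_tendsto_strength (hm : 1 ≤ m) (h0 : 0 ≤ α) (h1 : α < 1)
    (hψ : IsPolyaStrengths m α ψ P) {k : ℕ} (hk : 1 ≤ k) :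
    ∀ᵐ ω ∂P, Tendsto
      (fun n : ℕ => totalWeight m α n * strength ψ k n ω / (n : ℝ) ^ (1 - chi α)) atTop
      (𝓝 (degLimit m α ψ k ω)) := by
  filter_upwards [hψ.ae_tendsto_limF hm h0 h1 hk] with ω h
  have h2 := (((tendsto_one_sub_div (2 * (1 - chi α))).const_mul
    ((m : ℝ) / (1 - chi α))).mul_const ((k : ℝ) ^ chi α)).mul (h.const_mul (ψ k ω))
  rw [mul_one, ← mul_assoc] at h2
  refine h2.congr' ?_
  filter_upwards [eventually_ge_atTop 1] with n hn
  exact (totalWeight_mul_strength_div m h1 hk hn ω).symm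

lemma IsPolyaStrengths.tendsto_laplace (hm : 1 ≤ m) (h0 : 0 ≤ α) (h1 : α < 1)
    (hψ : IsPolyaStrengths m α ψ P) {k : ℕ} (hk : 1 ≤ k) {t : ℝ} (ht : 0 ≤ t) :
    Tendsto (fun n : ℕ => ∫ G, Real.exp (-(t * scaledDeg α k n G)) ∂(graphLaw m α n).toMeasure)
      atTop (𝓝 (∫ ω, Real.exp (-(t * degLimit m α ψ k ω)) ∂P)) := by
  set N : ℕ → ℝ := fun n => (n : ℝ) ^ (1 - chi α) with hN
  have hNtop : Tendsto N atTop atTop := tendsto_rpow_one_sub_chi h1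
  set z : ℕ → ℝ := fun n => Real.exp (t / N n) - 1 with hz
  have hzN : Tendsto (fun n => z n * N n) atTop (𝓝 t) := tendsto_exp_div_sub_one_mul hNtop t
  have htN : Tendsto (fun n => t / N n) atTop (𝓝 0) := tendsto_const_nhds.div_atTop hNtop
  have hz0 : Tendsto z atTop (𝓝 0) := by
    have := ((Real.continuous_exp.tendsto 0).comp htN).sub_const 1
    simpa [Function.comp_def] using this
  have hzpos : ∀ᶠ n in atTop, 0 ≤ z n := by
    filter_upwards [hNtop.eventually_gt_atTop 0] with n hn
    have := Real.one_le_exp (show 0 ≤ t / N n by positivity)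
    simp only [hz]
    linarith
  have hS := hψ.ae_strength_mem hk
  have hdct : Tendsto (fun n => ∫ ω, (1 + z n * strength ψ k n ω) ^ (-totalWeight m α n) ∂P)
      atTop (𝓝 (∫ ω, Real.exp (-(t * degLimit m α ψ k ω)) ∂P)) := by
    refine tendsto_integral_filter_of_dominated_convergence (fun _ => (1 : ℝ)) ?_ ?_
      (integrable_const _) ?_
    · refine Eventually.of_forall fun n => AEMeasurable.aestronglyMeasurable ?_
      exact (((hψ.aemeasurable_strength hk n).const_mul _).const_add _).pow_const _
    · filter_upwards [hzpos, eventually_ge_atTop 2] with n hzn hn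
      filter_upwards [hS] with ω h
      have h2 : 1 ≤ 1 + z n * strength ψ k n ω := by
        linarith [mul_nonneg hzn (h n).1]
      rw [Real.norm_eq_abs, abs_of_nonneg (by positivity)]
      exact Real.rpow_le_one_of_one_le_of_nonpos h2
        (neg_nonpos.2 (totalWeight_pos hm h0 h1 hn).le)
    · filter_upwards [hS, hψ.ae_tendsto_strength hm h0 h1 hk] with ω h h2
      refine tendsto_one_add_rpow_neg ?_ ?_ ?_ ?_
      · filter_upwards [hzpos] with n hn using mul_nonneg hn (h n).1
      · filter_upwards [eventually_ge_atTop 2] with n hn using (totalWeight_pos hm h0 h1 hn).le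
      · refine tendsto_of_tendsto_of_tendsto_of_le_of_le' tendsto_const_nhds hz0 ?_ ?_
        · filter_upwards [hzpos] with n hn using mul_nonneg hn (h n).1
        · filter_upwards [hzpos] with n hn using mul_le_of_le_one_right hn (h n).2
      · refine (hzN.mul h2).congr' ?_
        filter_upwards [hNtop.eventually_gt_atTop 0] with n hn
        have : (n : ℝ) ^ (1 - chi α) = N n := rfl
        rw [this]
        field_simp
  -- The shift by `2mu` between the degree and the weight disappears in the limit.
  have hcorr : Tendsto (fun n => Real.exp (t / N n * (2 * m * uParam α))) atTop (𝓝 1) := by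
    have := (Real.continuous_exp.tendsto _).comp (htN.mul_const (2 * m * uParam α))
    simpa [Function.comp_def] using this
  have hprod := hcorr.mul hdct
  rw [one_mul] at hprod
  refine hprod.congr' ?_
  filter_upwards [hzpos, hz0.eventually_lt_const one_pos, eventually_ge_atTop (max k 2)]
    with n hzn hzn1 hn
  rw [← hψ.integral_one_add_rpow_deg hm h0 h1 hk hn hzn hzn1, ← integral_const_mul]
  refine integral_congr_ae (Eventually.of_forall fun G => ?_)
  have e : 1 + z n = Real.exp (t / N n) := by simp only [hz]; ring
  simp only [scaledDeg]
  rw [e, ← Real.exp_mul, ← Real.exp_add]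
  congr 1
  change _ = -(t * ((deg G k : ℝ) / N n))
  ring

end Degrees

/-! ### The expected degrees and convergence in distribution -/

lemma degLimit_eq {Ω : Type*} (ψ : ℕ → Ω → ℝ) (m : ℕ) (α : ℝ) (k : ℕ) :
    degLimit m α ψ k = fun ω =>
      (m : ℝ) / (1 - chi α) * (k : ℝ) ^ chi α * (ψ k ω * limF α ψ k ω) := by
  funext ω
  rw [degLimit, mul_assoc]

section DegreeLimits

variable {Ω : Type*} [MeasurableSpace Ω] {P : Measure Ω} [IsProbabilityMeasure P]
  {ψ : ℕ → Ω → ℝ} {m : ℕ} {α : ℝ}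

lemma IsPolyaStrengths.integrable_mul_partialF (hψ : IsPolyaStrengths m α ψ P) {k : ℕ}
    (hk : 1 ≤ k) (n : ℕ) : Integrable (fun ω => ψ k ω * partialF α ψ k n ω) P := by
  refine Integrable.bdd_mul (c := 1) ((hψ.memLp_partialF hk n 1).integrable le_rfl)
    (hψ.aemeasurable hk).aestronglyMeasurable ?_
  filter_upwards [hψ.ae_mem_Ioc hk] with ω h
  rw [Real.norm_eq_abs, abs_of_pos h.1]
  exact h.2

lemma IsPolyaStrengths.integrable_mul_limF (hm : 1 ≤ m) (h0 : 0 ≤ α) (h1 : α < 1)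
    (hψ : IsPolyaStrengths m α ψ P) {k : ℕ} (hk : 1 ≤ k) :
    Integrable (fun ω => ψ k ω * limF α ψ k ω) P := by
  refine Integrable.bdd_mul (c := 1) ((hψ.memLp_limF hm h0 h1 hk).integrable (by norm_num))
    (hψ.aemeasurable hk).aestronglyMeasurable ?_
  filter_upwards [hψ.ae_mem_Ioc hk] with ω h
  rw [Real.norm_eq_abs, abs_of_pos h.1]
  exact h.2

lemma IsPolyaStrengths.integrable_degLimit (hm : 1 ≤ m) (h0 : 0 ≤ α) (h1 : α < 1)
    (hψ : IsPolyaStrengths m α ψ P) {k : ℕ} (hk : 1 ≤ k) : Integrable (degLimit m α ψ k) P := by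
  rw [degLimit_eq]
  exact (hψ.integrable_mul_limF hm h0 h1 hk).const_mul _

lemma IsPolyaStrengths.tendsto_integral_mul_partialF (hm : 1 ≤ m) (h0 : 0 ≤ α) (h1 : α < 1)
    (hψ : IsPolyaStrengths m α ψ P) {k : ℕ} (hk : 1 ≤ k) :
    Tendsto (fun n => ∫ ω, ψ k ω * partialF α ψ k n ω ∂P) atTop
      (𝓝 (∫ ω, ψ k ω * limF α ψ k ω ∂P)) := by
  refine tendsto_integral_of_L1' _ (hψ.integrable_mul_limF hm h0 h1 hk).aestronglyMeasurable
    (Eventually.of_forall fun n => hψ.integrable_mul_partialF hk n) ?_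
  refine tendsto_of_tendsto_of_tendsto_of_le_of_le tendsto_const_nhds
    (hψ.tendsto_eLpNorm_partialF_sub_limF hm h0 h1 hk) (fun _ => zero_le) fun n => ?_
  refine le_trans (eLpNorm_mono_ae ?_) (eLpNorm_le_eLpNorm_of_exponent_le (by norm_num)
    ((hψ.aestronglyMeasurable_partialF k n).sub (hψ.aestronglyMeasurable_limF hm h0 h1 hk)))
  filter_upwards [hψ.ae_mem_Ioc hk] with ω h
  simp only [Pi.sub_apply, ← mul_sub, norm_mul, Real.norm_eq_abs, abs_of_pos h.1]
  exact mul_le_of_le_one_left (abs_nonneg _) h.2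

/-- The expectation of `ψ_k`. -/
noncomputable def meanStrength (m : ℕ) (α : ℝ) (k : ℕ) : ℝ :=
  if k = 1 then 1 else newWeight m α / totalWeight m α k

lemma IsPolyaStrengths.integral_mul_partialF (hm : 1 ≤ m) (h0 : 0 ≤ α) (h1 : α < 1)
    (hψ : IsPolyaStrengths m α ψ P) {k n : ℕ} (hk : 1 ≤ k) :
    ∫ ω, ψ k ω * partialF α ψ k n ω ∂P =
      meanStrength m α k * ∫ ω, partialF α ψ k n ω ∂P := by
  have h := hψ.integral_strength hm h0 h1 hk 1 n
  have h2 := hψ.integral_prod (s := Finset.Icc (k + 1) n)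
    (fun j hj => by have := Finset.mem_Icc.1 hj; omega) (g := fun _ x => (1 - x) ^ 1)
    (fun j => by fun_prop)
  rw [Finset.prod_congr rfl fun j hj => hψ.integral_one_sub_pow hm h0 h1
    (by have := Finset.mem_Icc.1 hj; omega) 1] at h2
  rw [strengthMoment, ← h2] at h
  simp only [pow_one, ascPochhammer_one, Polynomial.eval_X] at h
  have e : ∀ ω, ψ k ω * partialF α ψ k n ω = ((n : ℝ) / k) ^ chi α * strength ψ k n ω :=
    fun ω => by rw [partialF, strength]; ring
  simp only [e]
  simp only [partialF]
  rw [integral_const_mul, integral_const_mul, h, meanStrength]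
  ring

lemma IsPolyaStrengths.integral_mul_limF (hm : 1 ≤ m) (h0 : 0 ≤ α) (h1 : α < 1)
    (hψ : IsPolyaStrengths m α ψ P) {k : ℕ} (hk : 1 ≤ k) :
    ∫ ω, ψ k ω * limF α ψ k ω ∂P = meanStrength m α k * ∫ ω, limF α ψ k ω ∂P := by
  refine tendsto_nhds_unique (hψ.tendsto_integral_mul_partialF hm h0 h1 hk) ?_
  simp only [hψ.integral_mul_partialF hm h0 h1 hk]
  exact (hψ.tendsto_integral_partialF hm h0 h1 hk).const_mul _

lemma IsPolyaStrengths.tendsto_integral_scaledDeg (hm : 1 ≤ m) (h0 : 0 ≤ α) (h1 : α < 1)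
    (hψ : IsPolyaStrengths m α ψ P) {k : ℕ} (hk : 1 ≤ k) :
    Tendsto (fun n : ℕ => ∫ G, scaledDeg α k n G ∂(graphLaw m α n).toMeasure) atTop
      (𝓝 (∫ ω, degLimit m α ψ k ω ∂P)) := by
  have hlim := (((tendsto_one_sub_div (2 * (1 - chi α))).const_mul
    ((m : ℝ) / (1 - chi α))).mul_const ((k : ℝ) ^ chi α)).mul
      (hψ.tendsto_integral_mul_partialF hm h0 h1 hk)
  have hcorr := (tendsto_const_nhds (x := 2 * m * uParam α)).div_atTop
    (tendsto_rpow_one_sub_chi h1)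
  have hsub := hlim.sub hcorr
  rw [mul_one, sub_zero, ← integral_const_mul] at hsub
  rw [degLimit_eq]
  refine hsub.congr' ?_
  filter_upwards [eventually_ge_atTop (max k 2)] with n hn
  have hn1 : 1 ≤ n := by have := le_of_max_le_right hn; omega
  have h := hψ.integral_ascPochhammer_deg hm h0 h1 hk hn 1
  simp only [ascPochhammer_one, Polynomial.eval_X, pow_one] at h
  rw [integral_add (integrable_deg m α n k) (integrable_const _), integral_const, probReal_univ,
    one_smul] at h
  simp only [scaledDeg]
  rw [integral_div, eq_sub_of_add_eq h, sub_div, ← integral_const_mul, ← integral_const_mul,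
    ← integral_div]
  simp only [totalWeight_mul_strength_div m h1 hk hn1]

lemma scaledDeg_nonneg (α : ℝ) (k n : ℕ) (G : Multigraph) : 0 ≤ scaledDeg α k n G := by
  unfold scaledDeg
  positivity

lemma integrable_scaledDeg (m : ℕ) (α : ℝ) (k n : ℕ) :
    Integrable (scaledDeg α k n) (graphLaw m α n).toMeasure :=
  (integrable_deg m α n k).div_const _

lemma IsPolyaStrengths.ae_degLimit_nonneg (hm : 1 ≤ m) (h0 : 0 ≤ α) (h1 : α < 1)
    (hψ : IsPolyaStrengths m α ψ P) {k : ℕ} (hk : 1 ≤ k) :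
    ∀ᵐ ω ∂P, 0 ≤ degLimit m α ψ k ω := by
  filter_upwards [hψ.ae_mem_Ioc hk, hψ.ae_limF_pos hm h0 h1 hk] with ω h h2
  have h3 : 0 < 1 - chi α := by linarith [chi_lt_one h1]
  have := h.1
  unfold degLimit
  positivity

lemma IsPolyaStrengths.tendstoInDistribution_scaledDeg (hm : 1 ≤ m) (h0 : 0 ≤ α) (h1 : α < 1)
    (hψ : IsPolyaStrengths m α ψ P) {k : ℕ} (hk : 1 ≤ k) :
    TendstoInDistribution (fun n : ℕ => scaledDeg α k n) atTop (degLimit m α ψ k)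
      (fun n : ℕ => (graphLaw m α n).toMeasure) P := by
  have hnn := hψ.ae_degLimit_nonneg hm h0 h1 hk
  obtain ⟨C, hC⟩ := (hψ.tendsto_integral_scaledDeg hm h0 h1 hk).bddAbove_range
  have hmain : TendstoInDistribution (fun n G => (scaledDeg α k n G).toNNReal) atTop
      (fun ω => (degLimit m α ψ k ω).toNNReal) (fun n : ℕ => (graphLaw m α n).toMeasure) P := by
    refine tendstoInDistribution_of_tendsto_laplace (C := C.toNNReal)
      (fun n => (measurable_of_countable _).aemeasurable)
      (hψ.integrable_degLimit hm h0 h1 hk).aestronglyMeasurable.aemeasurable.real_toNNReal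
      (fun n => ?_) (fun i => ?_)
    · change ∫⁻ G, ENNReal.ofReal (scaledDeg α k n G) ∂(graphLaw m α n).toMeasure ≤
        ENNReal.ofReal C
      rw [← ofReal_integral_eq_lintegral_ofReal (integrable_scaledDeg m α k n)
        (Eventually.of_forall fun G => scaledDeg_nonneg α k n G)]
      exact ENNReal.ofReal_le_ofReal (hC ⟨n, rfl⟩)
    · simp only [Real.coe_toNNReal _ (scaledDeg_nonneg α k _ _)]
      have e : ∫ ω, Real.exp (-(i * ((degLimit m α ψ k ω).toNNReal : ℝ))) ∂P =
          ∫ ω, Real.exp (-(i * degLimit m α ψ k ω)) ∂P :=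
        integral_congr_ae (hnn.mono fun ω h => by simp only [Real.coe_toNNReal _ h])
      rw [e]
      exact hψ.tendsto_laplace hm h0 h1 hk i.cast_nonneg
  refine (hmain.continuous_comp NNReal.continuous_coe).congr
    (fun n => Eventually.of_forall fun G => ?_) (hnn.mono fun ω h => ?_)
  · exact Real.coe_toNNReal _ (scaledDeg_nonneg α k n G)
  · exact Real.coe_toNNReal _ h

/-- The relative error in the asymptotics of the expected degree of `k`: since
`E ψ_k = χ / (k - 2 (1 - χ))` for `k ≥ 2`, it is `O(1 / k)`. -/
lemma IsPolyaStrengths.abs_meanStrength_mul_integral_limF_le (hm : 1 ≤ m) (h0 : 0 ≤ α)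
    (h1 : α < 1) (hψ : IsPolyaStrengths m α ψ P) {k : ℕ} (hk : 1 ≤ k) :
    |k * meanStrength m α k * (∫ ω, limF α ψ k ω ∂P) / chi α - 1| ≤ (2 * errConst + 3) / k := by
  have hχ0 := half_le_chi h0 h1
  have hχ1 := chi_lt_one h1
  have hE := errConst_pos
  have hF := hψ.abs_integral_limF_sub_one_le hm h0 h1 hk
  generalize ∫ ω, limF α ψ k ω ∂P = f at *
  unfold meanStrength
  obtain rfl | hk2 := hk.eq_or_lt
  · rw [if_pos rfl]
    simp only [Nat.cast_one, div_one, one_mul] at hF ⊢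
    obtain ⟨h2, h3⟩ := abs_le.1 hF
    rw [abs_le, le_sub_iff_add_le, sub_le_iff_le_add, le_div_iff₀ (by linarith),
      div_le_iff₀ (by linarith)]
    constructor <;> nlinarith
  · have hk2' : (2 : ℝ) ≤ k := by exact_mod_cast hk2
    have hm' : (1 : ℝ) ≤ m := by exact_mod_cast hm
    have hA : (m : ℝ) / (1 - chi α) ≠ 0 := (div_pos (by linarith) (by linarith)).ne'
    rw [if_neg (by omega), newWeight_eq m h1, totalWeight_eq m h1, mul_div_mul_left _ _ hA]
    generalize chi α = χ at *
    have hd : 0 < (k : ℝ) - 2 * (1 - χ) := by linarith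
    have e : k * (χ / (k - 2 * (1 - χ))) * f / χ - 1 =
        k / (k - 2 * (1 - χ)) * (f - 1) + 2 * (1 - χ) / (k - 2 * (1 - χ)) := by
      field_simp
      ring
    have h2 : (k : ℝ) / (k - 2 * (1 - χ)) ≤ 2 := by rw [div_le_iff₀ hd]; linarith
    have h3 : 2 * (1 - χ) / (k - 2 * (1 - χ)) ≤ 3 / k := by
      rw [div_le_div_iff₀ hd (by linarith)]
      nlinarith
    have h4 : 0 ≤ 2 * (1 - χ) / (k - 2 * (1 - χ)) := div_nonneg (by linarith) hd.le
    rw [e]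
    refine (abs_add_le _ _).trans ?_
    rw [abs_mul, abs_of_nonneg h4, abs_of_nonneg (by positivity)]
    calc k / (k - 2 * (1 - χ)) * |f - 1| + 2 * (1 - χ) / (k - 2 * (1 - χ))
        ≤ 2 * (errConst / k) + 3 / k :=
          add_le_add (mul_le_mul h2 hF (abs_nonneg _) (by norm_num)) h3
      _ = (2 * errConst + 3) / k := by ring

end DegreeLimits

end PrefAttach

open PrefAttach
theorem lemma5p1 (m : ℕ) (hm : 2 ≤ m) (α : ℝ) (hα0 : 0 ≤ α) (hα1 : α < 1)
    {Ω : Type*} [MeasurableSpace Ω] (P : Measure Ω) [IsProbabilityMeasure P]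
    (ψ : ℕ → Ω → ℝ) (hψ : IsPolyaStrengths m α ψ P) :
    -- the limit defining `F_k` exists almost surely and in `L²`
    (∀ k : ℕ, 1 ≤ k →
      (∀ᵐ ω ∂P, Tendsto (fun ℓ : ℕ => partialF α ψ k ℓ ω) atTop (𝓝 (limF α ψ k ω))) ∧
      (∀ ℓ : ℕ, MemLp (partialF α ψ k ℓ) 2 P) ∧ MemLp (limF α ψ k) 2 P ∧
      Tendsto (fun ℓ : ℕ => eLpNorm (partialF α ψ k ℓ - limF α ψ k) 2 P) atTop (𝓝 0)) ∧
    -- convergence of the rescaled degrees in expectation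
    (∀ k : ℕ, 1 ≤ k →
      (∀ n : ℕ, Integrable (scaledDeg α k n) (graphLaw m α n).toMeasure) ∧
      Integrable (degLimit m α ψ k) P ∧
      Tendsto (fun n : ℕ => ∫ G, scaledDeg α k n G ∂(graphLaw m α n).toMeasure) atTop
        (𝓝 (∫ ω, degLimit m α ψ k ω ∂P))) ∧
    -- convergence of the rescaled degrees in distribution
    (∀ k : ℕ, 1 ≤ k →
      TendstoInDistribution (fun n : ℕ => scaledDeg α k n) atTop (degLimit m α ψ k)
        (fun n : ℕ => (graphLaw m α n).toMeasure) P) ∧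
    -- properties of `F_k`
    (∀ k : ℕ, 1 ≤ k → ∀ᵐ ω ∂P, 0 < limF α ψ k ω) ∧
    IsBigOPInvSqrt P (fun k ω => Real.log (limF α ψ k ω)) ∧
    (∃ C : ℝ, ∀ k : ℕ, 1 ≤ k → |(∫ ω, limF α ψ k ω ∂P) - 1| ≤ C / k) ∧
    -- the resulting asymptotics of the expected degrees
    (∃ (C : ℝ) (ρ : ℕ → ℝ), ∀ k : ℕ, 1 ≤ k → |ρ k| ≤ C / k ∧
      Tendsto (fun n : ℕ =>
          (∫ G, (deg G k : ℝ) ∂(graphLaw m α n).toMeasure) / (n : ℝ) ^ (1 - chi α)) atTop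
        (𝓝 (m * chi α / (1 - chi α) * (1 / (k : ℝ) ^ (1 - chi α)) * (1 + ρ k)))) := by
  have hm1 : 1 ≤ m := by omega
  refine ⟨fun k hk => ⟨hψ.ae_tendsto_limF hm1 hα0 hα1 hk, fun l => hψ.memLp_partialF hk l 2,
      hψ.memLp_limF hm1 hα0 hα1 hk, hψ.tendsto_eLpNorm_partialF_sub_limF hm1 hα0 hα1 hk⟩,
    fun k hk => ⟨integrable_scaledDeg m α k, hψ.integrable_degLimit hm1 hα0 hα1 hk,
      hψ.tendsto_integral_scaledDeg hm1 hα0 hα1 hk⟩,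
    fun k hk => hψ.tendstoInDistribution_scaledDeg hm1 hα0 hα1 hk,
    fun k hk => hψ.ae_limF_pos hm1 hα0 hα1 hk, hψ.isBigOPInvSqrt_log_limF hm1 hα0 hα1,
    ⟨errConst, fun k hk => hψ.abs_integral_limF_sub_one_le hm1 hα0 hα1 hk⟩,
    2 * errConst + 3,
    fun k => k * meanStrength m α k * (∫ ω, limF α ψ k ω ∂P) / chi α - 1, fun k hk => ⟨?_, ?_⟩⟩
  · exact hψ.abs_meanStrength_mul_integral_limF_le hm1 hα0 hα1 hk
  · have hk0 : (0 : ℝ) < k := by exact_mod_cast hk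
    have h := hψ.tendsto_integral_scaledDeg hm1 hα0 hα1 hk
    simp only [scaledDeg, integral_div] at h
    convert h using 2
    have hχ := half_le_chi hα0 hα1
    have hχ1 : 1 - chi α ≠ 0 := by linarith [chi_lt_one hα1]
    rw [degLimit_eq, integral_const_mul, hψ.integral_mul_limF hm1 hα0 hα1 hk, add_sub_cancel,
      Real.rpow_sub hk0, Real.rpow_one]
    have : (0 : ℝ) < (k : ℝ) ^ chi α := by positivity
    have : chi α ≠ 0 := by linarith
    field_simp
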